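/- For $0\le r<1$ let $\mathbb A_r:=\{z\in\mathbb C: r<|z|<1\}$, and put $\omega(r):=-\pi/\log r$ for $r\in(0,1)$, $\omega(0):=0$. Let $d\in[1,+\infty]$. A family $(D_t)_{t\ge0}$ of annuli $D_t=\mathbb A_{r(t)}$, where $r:[0,+\infty)\to[0,1)$, is called a canonical $L^d$-system if the function $t\mapsto\omega(r(t))$ is non-increasing and locally absolutely continuous on $[0,+\infty)$, with derivative in $L^d_{\rm loc}([0,+\infty))$. An $L^d$-evolution family over $(D_t)$ is a family $(\varphi_{s,t})_{0\le s\le t<+\infty}$ of holomorphic maps $\varphi_{s,t}:D_s\to D_t$ such that (EF1) $\varphi_{s,s}=\mathsf{id}_{D_s}$ for all $s\ge0$; (EF2) $\varphi_{s,t}=\varphi_{u,t}\circ\varphi_{s,u}$ whenever $0\le s\le u\le t<+\infty$; (EF3) for any closed interval $I=[S,T]\subset[0,+\infty)$ and any $z\in D_S$ there exists a non-negative function $k_{z,I}\in L^d([S,T],\mathbb R)$ such that $|\varphi_{s,u}(z)-\varphi_{s,t}(z)|\le\int_u^t k_{z,I}(\xi)\,d\xi$ whenever $S\le s\le u\le t\le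 T$. **Proposition.** Let $d\in[1,+\infty]$ and let $(\varphi_{s,t})$ be an $L^d$-evolution family over a canonical $L^d$-system $(D_t)=(\mathbb A_{r(t)})$. Then for any closed interval $I:=[S,T]\subset[0,+\infty)$ and any compact set $K\subset D_S$ there exists a non-negative function $k_{K,I}\in L^d(I,\mathbb R)$ such that $$\sup_{z\in K}|\varphi_{s,t}(z)-\varphi_{s,u}(z)|\le\int_u^t k_{K,I}(\xi)\,d\xi$$ for all $s,u,t\in I$ satisfying $s\le u\le t$. -/

import Mathlib

open MeasureTheory
open scoped ENNReal

namespace AnnulusEvolution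

/-- The annulus `{z : r < |z| < 1}`; for `r = 0` it is the punctured unit disk. -/
def annulus (r : ℝ) : Set ℂ := {z : ℂ | r < ‖z‖ ∧ ‖z‖ < 1}

/-- The conformal parameter of the annulus: `ω(r) = -π / log r` for `r ∈ (0,1)` and `ω(0) = 0`. -/
noncomputable def omega (r : ℝ) : ℝ := if r = 0 then 0 else -Real.pi / Real.log r

/-- The class `AC^d` on an interval `X ⊆ ℝ`: locally absolutely continuous functions on `X` (that
is, absolutely continuous on every compact interval contained in `X`) whose derivative is of class
`L^d` on every compact interval contained in `X`. Only the values of `f` on `X` matter, since the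
endpoints of an interval form a null set. -/
def IsACLoc (d : ℝ≥0∞) (f : ℝ → ℝ) (X : Set ℝ) : Prop :=
  ∀ a b : ℝ, a ≤ b → Set.Icc a b ⊆ X →
    AbsolutelyContinuousOnInterval f a b ∧ MemLp (deriv f) d (volume.restrict (Set.Icc a b))

/-- The annuli `D_t = annulus (r t)`, `t ≥ 0`, form a (doubly connected) canonical domain system of
order `d`. Only the values `r t` with `t ≥ 0` matter. -/
structure IsCanonicalSystem (d : ℝ≥0∞) (r : ℝ → ℝ) : Prop where
  radius_mem : ∀ t : ℝ, 0 ≤ t → r t ∈ Set.Ico (0 : ℝ) 1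
  omega_ac : IsACLoc d (fun t => omega (r t)) (Set.Ici 0)
  omega_antitone : AntitoneOn (fun t => omega (r t)) (Set.Ici 0)

/-- `(φ s t)`, `0 ≤ s ≤ t`, is an evolution family of order `d` over the annuli
`D_t = annulus (r t)`. Only the values `φ s t z` with `0 ≤ s ≤ t` and `z ∈ D_s` matter. -/
structure IsEvolutionFamily (d : ℝ≥0∞) (r : ℝ → ℝ) (φ : ℝ → ℝ → ℂ → ℂ) : Prop where
  holomorphic : ∀ s t : ℝ, 0 ≤ s → s ≤ t → DifferentiableOn ℂ (φ s t) (annulus (r s))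
  mapsTo : ∀ s t : ℝ, 0 ≤ s → s ≤ t → Set.MapsTo (φ s t) (annulus (r s)) (annulus (r t))
  id_of_eq : ∀ s : ℝ, 0 ≤ s → ∀ z ∈ annulus (r s), φ s s z = z
  comp : ∀ s u t : ℝ, 0 ≤ s → s ≤ u → u ≤ t →
    ∀ z ∈ annulus (r s), φ s t z = φ u t (φ s u z)
  regular : ∀ S T : ℝ, 0 ≤ S → S ≤ T → ∀ z ∈ annulus (r S),
    ∃ k : ℝ → ℝ, (∀ ξ ∈ Set.Icc S T, 0 ≤ k ξ) ∧
      MemLp k d (volume.restrict (Set.Icc S T)) ∧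
      ∀ s u t : ℝ, S ≤ s → s ≤ u → u ≤ t → t ≤ T →
        ‖φ s u z - φ s t z‖ ≤ ∫ ξ in u..t, k ξ

/-- The Chebyshev norm `‖f‖_K = sup_{z ∈ K} |f z|`, with values in `[0, ∞]`. -/
noncomputable def supNormOn (K : Set ℂ) (f : ℂ → ℂ) : ℝ≥0∞ := ⨆ z ∈ K, ‖f z‖ₑ

end AnnulusEvolution

namespace AnnulusEvolution

open Set Filter Topology Complex

/-! ### Holomorphic logarithms and the Schwarz–Pick inequality -/

/-! By (EF2), `φ s t z - φ s u z` is the displacement of the point `φ s u z` under `φ u t`. It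
therefore suffices to dominate the displacement of `φ u t` uniformly near each point `w₀` of `D_τ`,
for times near `τ`. Joint continuity of `φ s u z` and compactness of the set of triples `(s, u, z)`
then leave one density valid for short time steps, and additivity of the integral removes the
shortness (`exists_density_of_isCompact`, `norm_sub_le_of_local`).

Axiom (EF3) controls only the displacement of the single point `w₀`. Passing to a disk uses the
geometry of annuli. For close times, `f = φ u t` moves some circle so little that it is homotopic to
the inclusion, so it lifts to a map of strips commuting with translation by `2πi`. Schwarz–Pick for
the pair `w`, `w + 2πi` gives an inequality between `ω`, `x = -log |z|` and the corresponding data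
of `f z` (`sinQuot_mul_le`). Where `ω x < π/2` the sine is increasing, and the inequality becomes
`|f z / z| ≤ M` with `M = exp (C (ω - ω'))`; where `ω x > π/2`, reflection in the middle circle
gives `|z / f z| ≤ M`.

A holomorphic `q` with `|q| ≤ M` on a disk satisfies `|q - 1| ≤ 4 (M - 1) + 3 |q(w₀) - 1|` on the
half-size disk (Borel–Carathéodory). Hence the displacement near `w₀` is bounded by the decrease of
`ω` plus the displacement of `w₀`, both of which have densities in `L^d`. Points on the middle
circle are reached by the maximum principle for `f - id` between an inner and an outer circle
(`hasLocalDensity`). -/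

theorem exists_differentiableOn_log {U : Set ℂ} (hU : Convex ℝ U) (hUo : IsOpen U)
    (hne : U.Nonempty) {g : ℂ → ℂ} (hg : DifferentiableOn ℂ g U) (h0 : ∀ z ∈ U, g z ≠ 0) :
    ∃ F : ℂ → ℂ, DifferentiableOn ℂ F U ∧ ∀ z ∈ U, exp (F z) = g z := by
  have hsc : IsSimplyConnected U := by
    have := hU.contractibleSpace hne
    exact SimplyConnectedSpace.ofContractible U
  obtain ⟨F, hFc, hF⟩ := Complex.exists_continuousOn_eqOn_exp_comp hsc hUo hg.continuousOn
    (by rintro ⟨z, hz, h⟩; exact h0 z hz h)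
  refine ⟨F, fun a ha => ?_, hF⟩
  have hUa := hUo.mem_nhds ha
  have hFa : ContinuousAt F a := hFc.continuousAt hUa
  have hga : DifferentiableAt ℂ g a := hg.differentiableAt hUa
  have him : ∀ᶠ z in 𝓝 a, |(F z - F a).im| < Real.pi := by
    have : ContinuousAt (fun z => |(F z - F a).im|) a := by fun_prop
    exact this.eventually_lt continuousAt_const (by simpa using Real.pi_pos)
  -- Near `a` the imaginary part of `F z - F a` stays in `(-π, π)`, so the continuous logarithm is a
  -- shifted principal branch and inherits its differentiability.
  have hloc : F =ᶠ[𝓝 a] fun z => F a + log (g z / g a) := by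
    filter_upwards [him, hUa] with z hz hzU
    have h1 : exp (F z) = g z := hF hzU
    have h2 : exp (F a) = g a := hF ha
    rw [← h1, ← h2, ← exp_sub, log_exp (by linarith [(abs_lt.1 hz).1]) (abs_lt.1 hz).2.le]
    ring
  have hd : DifferentiableAt ℂ (fun z => F a + log (g z / g a)) a := by
    refine (differentiableAt_const _).add ((hga.div_const _).clog ?_)
    simp [div_self (h0 a ha)]
  exact (hloc.differentiableAt_iff.2 hd).differentiableWithinAt

/-- A continuous function with `exp ∘ D = 1` on a preconnected set is constant there. -/
theorem eq_of_exp_eq_one {X : Type*} [TopologicalSpace X] {s : Set X} (hs : IsPreconnected s)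
    {D : X → ℂ} (hD : ContinuousOn D s) (h1 : ∀ x ∈ s, exp (D x) = 1) {x y : X}
    (hx : x ∈ s) (hy : y ∈ s) : D x = D y := by
  refine hs.constant_of_mapsTo
    (T := (AddSubgroup.zmultiples (2 * (Real.pi : ℂ) * I) : Set ℂ)) ?_ hD ?_ hx hy
  · exact ⟨NormedSpace.discreteTopology_zmultiples _⟩
  · intro x hx
    obtain ⟨n, hn⟩ := exp_eq_one_iff.1 (h1 x hx)
    exact AddSubgroup.mem_zmultiples_iff.2 ⟨n, by rw [hn]; simp⟩

/-- Relates the two distances in the pseudo-hyperbolic quotient `|z - w| / |z - conj w|`; through it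
Schwarz–Pick takes a form without conjugates. -/
theorem normSq_sub_conj (z w : ℂ) :
    normSq (z - (starRingEnd ℂ) w) = normSq (z - w) + 4 * z.im * w.im := by
  simp [normSq_apply]; ring

/-- The Schwarz–Pick inequality for holomorphic self-maps of the upper half-plane. -/
theorem schwarzPick_upperHalfPlane {G : ℂ → ℂ} (hG : DifferentiableOn ℂ G {z | 0 < z.im})
    (hm : MapsTo G {z | 0 < z.im} {z | 0 < z.im}) {z w : ℂ} (hz : 0 < z.im) (hw : 0 < w.im) :
    normSq (G z - G w) * (z.im * w.im) ≤ normSq (z - w) * ((G z).im * (G w).im) := by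
  have hGz : 0 < (G z).im := hm hz
  have hGw : 0 < (G w).im := hm hw
  have hpos : ∀ a b : ℂ, 0 < a.im → 0 < b.im → 0 < normSq (a - (starRingEnd ℂ) b) := by
    intro a b ha hb
    rw [normSq_sub_conj]
    have := normSq_nonneg (a - b)
    positivity
  have hne : ∀ a b : ℂ, 0 < a.im → 0 < b.im → a - (starRingEnd ℂ) b ≠ 0 :=
    fun a b ha hb => normSq_pos.1 (hpos a b ha hb)
  have hlt : ∀ a b : ℂ, 0 < a.im → 0 < b.im → ‖(a - b) / (a - (starRingEnd ℂ) b)‖ < 1 := by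
    intro a b ha hb
    rw [norm_div, div_lt_one (norm_pos_iff.2 (hne a b ha hb)), ← sq_lt_sq₀ (norm_nonneg _)
      (norm_nonneg _), ← normSq_eq_norm_sq, ← normSq_eq_norm_sq, normSq_sub_conj]
    have : 0 < 4 * a.im * b.im := by positivity
    linarith
  -- The inverse of the Cayley map `z ↦ (z - w) / (z - conj w)`. Conjugating `G` by the Cayley maps
  -- centred at `w` and `G w` reduces the claim to the Schwarz lemma at `0`.
  let inv : ℂ → ℂ := fun ζ => (w - (starRingEnd ℂ) w * ζ) / (1 - ζ)
  have hζ1 : ∀ ζ ∈ Metric.ball (0 : ℂ) 1, 1 - ζ ≠ 0 := by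
    intro ζ hζ h
    rw [mem_ball_zero_iff] at hζ
    rw [← sub_eq_zero.1 h] at hζ
    simp at hζ
  have hinv : ∀ ζ ∈ Metric.ball (0 : ℂ) 1, 0 < (inv ζ).im := by
    intro ζ hζ
    have h1 := hζ1 ζ hζ
    have hn : 0 < normSq (1 - ζ) := normSq_pos.2 h1
    have : (inv ζ).im = w.im * (1 - normSq ζ) / normSq (1 - ζ) := by
      simp only [inv, div_im, sub_im, sub_re, mul_im, mul_re, conj_re, conj_im, one_re, one_im]
      rw [div_sub_div_same]
      congr 1
      simp only [normSq_apply]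
      ring
    rw [this]
    have h2 : normSq ζ < 1 := by
      rw [normSq_eq_norm_sq]
      rw [mem_ball_zero_iff] at hζ
      nlinarith [norm_nonneg ζ]
    have : 0 < 1 - normSq ζ := by linarith
    positivity
  let h : ℂ → ℂ := fun ζ => (G (inv ζ) - G w) / (G (inv ζ) - (starRingEnd ℂ) (G w))
  have hGinv : DifferentiableOn ℂ (fun ζ => G (inv ζ)) (Metric.ball 0 1) := by
    refine hG.comp ?_ hinv
    exact DifferentiableOn.div (by fun_prop) (by fun_prop) hζ1
  have hd : DifferentiableOn ℂ h (Metric.ball 0 1) :=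
    DifferentiableOn.div (hGinv.sub_const _) (hGinv.sub_const _)
      fun ζ hζ => hne _ _ (hm (hinv ζ hζ)) hGw
  have hmaps : MapsTo h (Metric.ball 0 1) (Metric.closedBall 0 1) := by
    intro ζ hζ
    exact mem_closedBall_zero_iff.2 (hlt _ _ (hm (hinv ζ hζ)) hGw).le
  have hh0 : h 0 = 0 := by simp [h, inv]
  have hzw := hne z w hz hw
  have key := Complex.norm_le_norm_of_mapsTo_ball hd hmaps hh0 (hlt z w hz hw)
  have hback : inv ((z - w) / (z - (starRingEnd ℂ) w)) = z := by
    have h1 : 1 - (z - w) / (z - (starRingEnd ℂ) w) =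
        (w - (starRingEnd ℂ) w) / (z - (starRingEnd ℂ) w) := by
      field_simp; ring
    have h2 : w - (starRingEnd ℂ) w ≠ 0 := hne w w hw hw
    simp only [inv]
    rw [h1]
    field_simp
    ring
  simp only [h, hback] at key
  rw [norm_div, norm_div, div_le_div_iff₀ (norm_pos_iff.2 (hne _ _ hGz hGw))
    (norm_pos_iff.2 hzw)] at key
  -- After squaring and expanding by `normSq_sub_conj`, the common term `normSq (G z - G w) * normSq
  -- (z - w)` cancels.
  have key2 := pow_le_pow_left₀ (by positivity) key 2
  rw [mul_pow, mul_pow, ← normSq_eq_norm_sq, ← normSq_eq_norm_sq, ← normSq_eq_norm_sq,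
    ← normSq_eq_norm_sq, normSq_sub_conj, normSq_sub_conj] at key2
  nlinarith

/-! ### Strips as conformal images of the upper half-plane -/

/-- `sin (ω x) / ω`, with its limit value `x` at `ω = 0`. -/
noncomputable def sinQuot (ω x : ℝ) : ℝ := if ω = 0 then x else Real.sin (ω * x) / ω

/-- `sinh (ω x) / ω`, with its limit value `x` at `ω = 0`. -/
noncomputable def sinhQuot (ω x : ℝ) : ℝ := if ω = 0 then x else Real.sinh (ω * x) / ω

/-- The strip `-π / ω < Re w < 0`, which is a half-plane for `ω = 0`. -/
def logStrip (ω : ℝ) : Set ℂ := {w | w.re < 0 ∧ ω * (-w.re) < Real.pi}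

/-- The conformal map of `logStrip ω` onto the upper half-plane. -/
noncomputable def toHalfPlane (ω : ℝ) (w : ℂ) : ℂ := if ω = 0 then -I * w else exp (-I * ω * w)

/-- The inverse of `toHalfPlane ω`. -/
noncomputable def ofHalfPlane (ω : ℝ) (ζ : ℂ) : ℂ := if ω = 0 then I * ζ else I / ω * log ζ

theorem sinQuot_pos {ω x : ℝ} (hω : 0 ≤ ω) (hx : 0 < x) (h : ω * x < Real.pi) :
    0 < sinQuot ω x := by
  unfold sinQuot
  split_ifs with h0
  · exact hx
  · have : 0 < ω := lt_of_le_of_ne hω (Ne.symm h0)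
    exact div_pos (Real.sin_pos_of_pos_of_lt_pi (by positivity) h) this

theorem sinhQuot_pos {ω x : ℝ} (hω : 0 ≤ ω) (hx : 0 < x) : 0 < sinhQuot ω x := by
  unfold sinhQuot
  split_ifs with h0
  · exact hx
  · have : 0 < ω := lt_of_le_of_ne hω (Ne.symm h0)
    exact div_pos (Real.sinh_pos_iff.2 (by positivity)) this

theorem isOpen_logStrip (ω : ℝ) : IsOpen (logStrip ω) := by
  refine IsOpen.and ?_ ?_
  · exact isOpen_lt (by fun_prop) (by fun_prop)
  · exact isOpen_lt (by fun_prop) (by fun_prop)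

theorem convex_logStrip {ω : ℝ} : Convex ℝ (logStrip ω) := by
  intro z hz w hw a b ha hb hab
  simp only [logStrip, mem_ofPred_eq, add_re, real_smul, re_ofReal_mul] at *
  constructor
  · rcases ha.eq_or_lt with rfl | ha
    · simp at hab; subst hab; simpa using hw.1
    · nlinarith [hz.1, hw.1]
  · have h1 : a * (ω * -z.re) + b * (ω * -w.re) < Real.pi := by
      rcases ha.eq_or_lt with rfl | ha
      · simp at hab; subst hab; simpa using hw.2
      · calc a * (ω * -z.re) + b * (ω * -w.re) < a * Real.pi + b * Real.pi := by
              nlinarith [hz.2, hw.2]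
          _ = Real.pi := by rw [← add_mul, hab, one_mul]
    nlinarith

theorem toHalfPlane_im_pos {ω : ℝ} (hω : 0 ≤ ω) {w : ℂ} (hw : w ∈ logStrip ω) :
    0 < (toHalfPlane ω w).im := by
  unfold toHalfPlane
  split_ifs with h0
  · simpa using hw.1
  · have : 0 < ω := lt_of_le_of_ne hω (Ne.symm h0)
    rw [exp_im]
    refine mul_pos (Real.exp_pos _) (Real.sin_pos_of_pos_of_lt_pi ?_ ?_)
    · have := hw.1
      simp
      nlinarith
    · simpa using hw.2

theorem differentiable_toHalfPlane (ω : ℝ) : Differentiable ℂ (toHalfPlane ω) := by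
  unfold toHalfPlane
  split_ifs <;> fun_prop

theorem mapsTo_ofHalfPlane {ω : ℝ} (hω : 0 ≤ ω) :
    MapsTo (ofHalfPlane ω) {z | 0 < z.im} (logStrip ω) := by
  intro z hz
  simp only [mem_ofPred_eq] at hz
  unfold ofHalfPlane
  split_ifs with h0
  · subst h0
    simp [logStrip, hz, Real.pi_pos]
  · have hpos : 0 < ω := lt_of_le_of_ne hω (Ne.symm h0)
    have hre : (I / ω * log z).re = -(arg z / ω) := by
      rw [div_mul_eq_mul_div, div_ofReal_re]
      simp [neg_div, log_im]
    have h1 : 0 < arg z := by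
      refine lt_of_le_of_ne (arg_nonneg_iff.2 hz.le) fun h => ?_
      have := (arg_eq_zero_iff.1 h.symm).2
      exact hz.ne' this
    have h2 : arg z < Real.pi := by
      refine lt_of_le_of_ne (arg_le_pi z) fun h => ?_
      exact hz.ne' (arg_eq_pi_iff.1 h).2
    refine ⟨?_, ?_⟩
    · rw [hre]; simp only [neg_lt_zero]; positivity
    · rw [hre, neg_neg, mul_div_cancel₀ _ h0]; exact h2

theorem differentiableOn_ofHalfPlane (ω : ℝ) :
    DifferentiableOn ℂ (ofHalfPlane ω) {z | 0 < z.im} := by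
  unfold ofHalfPlane
  split_ifs
  · fun_prop
  · refine DifferentiableOn.const_mul (DifferentiableOn.clog differentiableOn_id ?_) _
    intro z hz
    exact Or.inr (ne_of_gt hz)

theorem ofHalfPlane_toHalfPlane {ω : ℝ} (hω : 0 ≤ ω) {w : ℂ} (hw : w ∈ logStrip ω) :
    ofHalfPlane ω (toHalfPlane ω w) = w := by
  unfold ofHalfPlane toHalfPlane
  split_ifs with h0
  · rw [← mul_assoc]; simp
  · have hpos : 0 < ω := lt_of_le_of_ne hω (Ne.symm h0)
    have him : (-I * ω * w).im = ω * (-w.re) := by simp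
    rw [log_exp]
    · have : (ω : ℂ) ≠ 0 := by exact_mod_cast h0
      field_simp
      simp
    · rw [him]
      have := hw.1
      nlinarith [Real.pi_pos]
    · rw [him]; exact hw.2.le

/-- The pseudo-hyperbolic size of the translation by `2πi` on a strip. -/
theorem normSq_toHalfPlane_add_sub {ω : ℝ} (w : ℂ) :
    normSq (toHalfPlane ω (w + 2 * Real.pi * I) - toHalfPlane ω w) * sinQuot ω (-w.re) ^ 2 =
      4 * sinhQuot ω Real.pi ^ 2 *
        ((toHalfPlane ω (w + 2 * Real.pi * I)).im * (toHalfPlane ω w).im) := by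
  unfold toHalfPlane sinQuot sinhQuot
  split_ifs with h0
  · simp [normSq_apply]; ring
  -- Translation by `2πi` becomes dilation by `l ^ 2 = exp (2πω)`, so both image points lie on one
  -- ray, at angle `ω * (-w.re)`.
  · set E := Real.exp (ω * w.im) with hE
    set c := Real.cos (ω * (-w.re)) with hc
    set s := Real.sin (ω * (-w.re)) with hs
    set l := Real.exp (ω * Real.pi) with hl
    have hlpos : l ≠ 0 := (Real.exp_pos _).ne'
    have hcs : c ^ 2 + s ^ 2 = 1 := Real.cos_sq_add_sin_sq _
    have hr0 : (-I * ω * w).re = ω * w.im := by simp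
    have hi0 : (-I * ω * w).im = ω * -w.re := by simp
    have hr1 : (-I * ω * (w + 2 * Real.pi * I)).re =
        ω * w.im + (ω * Real.pi + ω * Real.pi) := by
      simp; ring
    have hi1 : (-I * ω * (w + 2 * Real.pi * I)).im = ω * -w.re := by simp
    rw [normSq_apply]
    simp only [sub_re, sub_im, exp_re, exp_im, hr0, hi0, hr1, hi1, Real.exp_add, Real.sinh_eq,
      Real.exp_neg, ← hE, ← hl, ← hs, ← hc]
    field_simp
    linear_combination (4 * E ^ 2 * (l ^ 2 - 1) ^ 2 * s ^ 2) * hcs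

/-! ### Holomorphic maps of annuli homotopic to the inclusion -/

theorem omega_nonneg {r : ℝ} (hr : r ∈ Ico (0 : ℝ) 1) : 0 ≤ omega r := by
  unfold omega
  split_ifs with h
  · exact le_rfl
  · exact div_nonneg_of_nonpos (by linarith [Real.pi_pos]) (Real.log_nonpos hr.1 hr.2.le)

/-- Treats the punctured disk and genuine annuli by one condition that depends continuously on `ω`;
later arguments need not separate `r = 0`. -/
theorem mem_annulus_iff {r : ℝ} (hr : r ∈ Ico (0 : ℝ) 1) {z : ℂ} :
    z ∈ annulus r ↔ z ≠ 0 ∧ ‖z‖ < 1 ∧ omega r * (-Real.log ‖z‖) < Real.pi := by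
  unfold omega
  split_ifs with h
  · subst h
    simp [annulus, Real.pi_pos]
  · have h0 : 0 < r := lt_of_le_of_ne hr.1 (Ne.symm h)
    have hl : Real.log r < 0 := Real.log_neg h0 hr.2
    have key : -Real.pi / Real.log r * -Real.log ‖z‖ < Real.pi ↔ Real.log r < Real.log ‖z‖ := by
      have : -Real.pi / Real.log r * -Real.log ‖z‖ = Real.pi * (Real.log ‖z‖ / Real.log r) := by
        ring
      rw [this, mul_lt_iff_lt_one_right Real.pi_pos, div_lt_one_of_neg hl]
    rw [key]
    constructor
    · rintro ⟨h1, h2⟩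
      refine ⟨?_, h2, Real.log_lt_log h0 h1⟩
      rintro rfl
      simp at h1
      linarith
    · rintro ⟨h1, h2, h3⟩
      exact ⟨(Real.log_lt_log_iff h0 (norm_pos_iff.2 h1)).1 h3, h2⟩

theorem exp_mem_annulus_iff {r : ℝ} (hr : r ∈ Ico (0 : ℝ) 1) {w : ℂ} :
    exp w ∈ annulus r ↔ w ∈ logStrip (omega r) := by
  rw [mem_annulus_iff hr, norm_exp, Real.log_exp]
  simp [logStrip, exp_ne_zero]

/-- A map of annuli which is close to the identity on one circle lifts to a map of strips that
commutes with the translation by `2πi`. -/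
theorem exists_lift {r r' : ℝ} (hr : r ∈ Ico (0 : ℝ) 1) (hr' : r' ∈ Ico (0 : ℝ) 1)
    {f : ℂ → ℂ} (hf : DifferentiableOn ℂ f (annulus r)) (hm : MapsTo f (annulus r) (annulus r'))
    {ρ : ℝ} (hρ0 : 0 < ρ) (hρ : (ρ : ℂ) ∈ annulus r) (hc : ∀ z : ℂ, ‖z‖ = ρ → ‖f z - z‖ < ρ) :
    ∃ F : ℂ → ℂ, DifferentiableOn ℂ F (logStrip (omega r)) ∧
      (∀ w ∈ logStrip (omega r), exp (F w) = f (exp w)) ∧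
      ∀ w ∈ logStrip (omega r), F (w + 2 * Real.pi * I) = F w + 2 * Real.pi * I := by
  have hmem : ∀ w ∈ logStrip (omega r), exp w ∈ annulus r :=
    fun w hw => (exp_mem_annulus_iff hr).2 hw
  have hexp : exp (Real.log ρ : ℂ) = ρ := by
    rw [← ofReal_exp, Real.exp_log hρ0]
  have hw0 : (Real.log ρ : ℂ) ∈ logStrip (omega r) := by
    rw [← exp_mem_annulus_iff hr, hexp]; exact hρ
  have hshift : ∀ w : ℂ, ∀ y : ℝ, w ∈ logStrip (omega r) → w + y * I ∈ logStrip (omega r) := by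
    intro w y hw
    simpa [logStrip] using hw
  obtain ⟨F, hFd, hF⟩ : ∃ F : ℂ → ℂ, DifferentiableOn ℂ F (logStrip (omega r)) ∧
      ∀ w ∈ logStrip (omega r), exp (F w) = f (exp w) :=
    exists_differentiableOn_log convex_logStrip (isOpen_logStrip (omega r))
    ⟨_, hw0⟩ (hf.comp differentiable_exp.differentiableOn hmem)
    (fun w hw => ((mem_annulus_iff hr').1 (hm (hmem w hw))).1)
  refine ⟨F, hFd, hF, ?_⟩
  have h2pi : ∀ w ∈ logStrip (omega r), w + 2 * Real.pi * I ∈ logStrip (omega r) := by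
    intro w hw
    simpa using hshift w (2 * Real.pi) hw
  have hexp2 : ∀ w : ℂ, exp (w + 2 * Real.pi * I) = exp w := exp_periodic
  -- the translation defect is a constant
  have hconst : ∀ w ∈ logStrip (omega r), F (w + 2 * Real.pi * I) - F w =
      F (Real.log ρ + 2 * Real.pi * I) - F (Real.log ρ) := by
    intro w hw
    refine eq_of_exp_eq_one (D := fun w => F (w + 2 * Real.pi * I) - F w)
      convex_logStrip.isPreconnected ?_ ?_ hw hw0
    · exact (hFd.continuousOn.comp (by fun_prop) h2pi).sub hFd.continuousOn
    · intro w hw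
      rw [exp_sub, hF _ (h2pi w hw), hF _ hw, hexp2, div_self]
      exact ((mem_annulus_iff hr').1 (hm (hmem w hw))).1
  -- and it is computed on the circle of radius `ρ`
  have hline : ∀ y : ℝ, (Real.log ρ : ℂ) + y * I ∈ logStrip (omega r) := fun y => hshift _ y hw0
  have hnorm : ∀ y : ℝ, ‖exp ((Real.log ρ : ℂ) + y * I)‖ = ρ := by
    intro y
    rw [norm_exp]
    simp [Real.exp_log hρ0]
  let q : ℝ → ℂ := fun y => f (exp (Real.log ρ + y * I)) / exp (Real.log ρ + y * I)
  have hq : ∀ y, q y ∈ slitPlane := by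
    intro y
    have h1 : ‖q y - 1‖ < 1 := by
      have : q y - 1 = (f (exp (Real.log ρ + y * I)) - exp (Real.log ρ + y * I)) /
          exp (Real.log ρ + y * I) := by
        simp only [q]
        rw [sub_div, div_self (exp_ne_zero _)]
      rw [this, norm_div, hnorm, div_lt_one hρ0]
      exact hc _ (hnorm y)
    have := mem_slitPlane_of_norm_lt_one h1
    simpa using this
  have hqc : Continuous q := by
    refine Continuous.div ?_ (by fun_prop) fun y => exp_ne_zero _
    exact hf.continuousOn.comp_continuous (by fun_prop) fun y => hmem _ (hline y)
  have hFc : Continuous fun y : ℝ => F (Real.log ρ + y * I) :=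
    hFd.continuousOn.comp_continuous (by fun_prop) hline
  -- On the circle, `f z / z` stays in the slit plane, so its principal logarithm is continuous and
  -- `F w - w - log q` is constant along the line. As `q` is `2π`-periodic, comparing `y = 0` with
  -- `y = 2π` gives a translation defect of exactly `2πi`.
  have hD := eq_of_exp_eq_one (s := (univ : Set ℝ))
    (D := fun y : ℝ => F (Real.log ρ + y * I) - (Real.log ρ + y * I) - log (q y))
    isPreconnected_univ
    (((hFc.sub (by fun_prop)).sub (hqc.clog hq)).continuousOn) (by
      intro y _
      have hqy : q y ≠ 0 := slitPlane_ne_zero (hq y)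
      rw [exp_sub, exp_sub, exp_log hqy, hF _ (hline y)]
      exact div_self hqy) (mem_univ (2 * Real.pi)) (mem_univ 0)
  have hqq : q (2 * Real.pi) = q 0 := by
    simp only [q]
    push_cast
    rw [hexp2]
    simp
  simp only [hqq] at hD
  push_cast at hD
  simp only [zero_mul, add_zero] at hD
  intro w hw
  have := hconst w hw
  linear_combination this + hD

/-- With `N / P = 4 (a / s) ^ 2`, and likewise for the primed data, the contraction `N' / P' ≤ N /
P` says `a' / s' ≤ a / s`; the form without division also allows vanishing `s` and `s'`. -/
theorem le_of_ratio_le {s s' a a' P P' N N' : ℝ} (hs : 0 ≤ s) (hs' : 0 ≤ s') (ha : 0 ≤ a)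
    (ha' : 0 ≤ a') (hP : 0 < P) (hP' : 0 < P') (h : N * s ^ 2 = 4 * a ^ 2 * P)
    (h' : N' * s' ^ 2 = 4 * a' ^ 2 * P') (hN : N' * P ≤ N * P') : s * a' ≤ s' * a := by
  have h1 : 4 * (P * P') * (s * a') ^ 2 ≤ 4 * (P * P') * (s' * a) ^ 2 := by
    calc 4 * (P * P') * (s * a') ^ 2 = (N' * P) * (s' ^ 2 * s ^ 2) := by
          linear_combination (-(P * s ^ 2)) * h'
      _ ≤ (N * P') * (s' ^ 2 * s ^ 2) := by gcongr
      _ = 4 * (P * P') * (s' * a) ^ 2 := by linear_combination (P' * s' ^ 2) * h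
  have h2 := le_of_mul_le_mul_left h1 (by positivity)
  exact (pow_le_pow_iff_left₀ (by positivity) (by positivity) two_ne_zero).1 h2

/-- Contraction of the hyperbolic length of the closed geodesic loops: the quotient
`sinQuot ω x / sinhQuot ω π`, where `x = -log |z|`, does not decrease under maps of annuli that are
close to the identity on one circle. -/
theorem sinQuot_mul_le {r r' : ℝ} (hr : r ∈ Ico (0 : ℝ) 1) (hr' : r' ∈ Ico (0 : ℝ) 1)
    {f : ℂ → ℂ} (hf : DifferentiableOn ℂ f (annulus r)) (hm : MapsTo f (annulus r) (annulus r'))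
    {ρ : ℝ} (hρ0 : 0 < ρ) (hρ : (ρ : ℂ) ∈ annulus r) (hc : ∀ z : ℂ, ‖z‖ = ρ → ‖f z - z‖ < ρ)
    {z : ℂ} (hz : z ∈ annulus r) :
    sinQuot (omega r) (-Real.log ‖z‖) * sinhQuot (omega r') Real.pi ≤
      sinQuot (omega r') (-Real.log ‖f z‖) * sinhQuot (omega r) Real.pi := by
  obtain ⟨F, hFd, hF, hF2⟩ := exists_lift hr hr' hf hm hρ0 hρ hc
  have hz' := (mem_annulus_iff hr).1 hz
  have hfz' := (mem_annulus_iff hr').1 (hm hz)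
  set ω := omega r
  set ω' := omega r'
  have hω : 0 ≤ ω := omega_nonneg hr
  have hω' : 0 ≤ ω' := omega_nonneg hr'
  set w := log z with hwdef
  have hew : exp w = z := exp_log hz'.1
  have hw : w ∈ logStrip ω := by rw [← exp_mem_annulus_iff hr, hew]; exact hz
  have hw2 : w + 2 * Real.pi * I ∈ logStrip ω := by simpa [logStrip] using hw
  have hFm : MapsTo F (logStrip ω) (logStrip ω') := by
    intro v hv
    rw [← exp_mem_annulus_iff hr', hF v hv]
    exact hm ((exp_mem_annulus_iff hr).2 hv)
  have hre : -w.re = -Real.log ‖z‖ := by rw [hwdef, log_re]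
  have hFre : -(F w).re = -Real.log ‖f z‖ := by
    rw [← hew, ← hF w hw, norm_exp, Real.log_exp]
  let G : ℂ → ℂ := fun ζ => toHalfPlane ω' (F (ofHalfPlane ω ζ))
  have hGd : DifferentiableOn ℂ G {z | 0 < z.im} :=
    (differentiable_toHalfPlane ω').comp_differentiableOn
      (hFd.comp (differentiableOn_ofHalfPlane ω) (mapsTo_ofHalfPlane hω))
  have hGm : MapsTo G {z | 0 < z.im} {z | 0 < z.im} := fun ζ hζ =>
    toHalfPlane_im_pos hω' (hFm (mapsTo_ofHalfPlane hω hζ))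
  have him0 := toHalfPlane_im_pos hω hw
  have him1 := toHalfPlane_im_pos hω hw2
  -- The points `w + 2πi` and `w` have `F`-images that again differ by `2πi`, so the same explicit
  -- formula evaluates both sides.
  have key := schwarzPick_upperHalfPlane hGd hGm him1 him0
  simp only [G, ofHalfPlane_toHalfPlane hω hw, ofHalfPlane_toHalfPlane hω hw2, hF2 w hw] at key
  have e1 := normSq_toHalfPlane_add_sub (ω := ω) w
  have e2 := normSq_toHalfPlane_add_sub (ω := ω') (F w)
  rw [hre] at e1
  rw [hFre] at e2
  have him0' := toHalfPlane_im_pos hω' (hFm hw)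
  have him1' : 0 < (toHalfPlane ω' (F w + 2 * Real.pi * I)).im := by
    rw [← hF2 w hw]; exact toHalfPlane_im_pos hω' (hFm hw2)
  have hx : 0 < -Real.log ‖z‖ := by
    have := Real.log_neg (norm_pos_iff.2 hz'.1) hz'.2.1; linarith
  have hx' : 0 < -Real.log ‖f z‖ := by
    have := Real.log_neg (norm_pos_iff.2 hfz'.1) hfz'.2.1; linarith
  have s1 := sinQuot_pos hω hx hz'.2.2
  have s2 := sinQuot_pos hω' hx' hfz'.2.2
  have a1 := sinhQuot_pos hω Real.pi_pos
  have a2 := sinhQuot_pos hω' Real.pi_pos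
  exact le_of_ratio_le s1.le s2.le a1.le a2.le (mul_pos him1 him0) (mul_pos him1' him0') e1 e2 key

/-! ### Estimates for `sinQuot` and `sinhQuot` -/

/-- The derivative in `x` has no exceptional case at `ω = 0`. The estimates that follow are mean
value inequalities in `x`, hence uniform as `ω → 0`. -/
theorem hasDerivAt_sinQuot (ω x : ℝ) : HasDerivAt (sinQuot ω) (Real.cos (ω * x)) x := by
  unfold sinQuot
  split_ifs with h
  · simpa [h] using hasDerivAt_id' x
  · have := (((hasDerivAt_id x).const_mul ω).sin).div_const ω
    simpa [h] using this

theorem hasDerivAt_sinhQuot (ω x : ℝ) : HasDerivAt (sinhQuot ω) (Real.cosh (ω * x)) x := by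
  unfold sinhQuot
  split_ifs with h
  · simpa [h] using hasDerivAt_id' x
  · have := (((hasDerivAt_id x).const_mul ω).sinh).div_const ω
    simpa [h] using this

theorem sinQuot_zero_right (ω : ℝ) : sinQuot ω 0 = 0 := by simp [sinQuot]

theorem sinhQuot_zero_right (ω : ℝ) : sinhQuot ω 0 = 0 := by simp [sinhQuot]

theorem mul_sub_le_of_hasDerivAt {f f' : ℝ → ℝ} (hf : ∀ x, HasDerivAt f (f' x) x) {a b C : ℝ}
    (hab : a ≤ b) (hC : ∀ x ∈ Icc a b, C ≤ f' x) : C * (b - a) ≤ f b - f a := by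
  refine (convex_Icc a b).mul_sub_le_image_sub_of_le_deriv
    (fun x _ => (hf x).continuousAt.continuousWithinAt)
    (fun x _ => (hf x).differentiableAt.differentiableWithinAt) ?_ a (left_mem_Icc.2 hab) b
    (right_mem_Icc.2 hab) hab
  intro x hx
  rw [(hf x).deriv]
  exact hC x (interior_subset hx)

theorem sub_le_mul_of_hasDerivAt {f f' : ℝ → ℝ} (hf : ∀ x, HasDerivAt f (f' x) x) {a b C : ℝ}
    (hab : a ≤ b) (hC : ∀ x ∈ Icc a b, f' x ≤ C) : f b - f a ≤ C * (b - a) := by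
  have := mul_sub_le_of_hasDerivAt (f := fun x => -f x) (f' := fun x => -f' x) (C := -C)
    (fun x => (hf x).neg) hab (fun x hx => neg_le_neg (hC x hx))
  linarith

theorem sinQuot_le_self {ω x : ℝ} (hx : 0 ≤ x) : sinQuot ω x ≤ x := by
  have := sub_le_mul_of_hasDerivAt (hasDerivAt_sinQuot ω) (C := 1) hx
    (fun y _ => Real.cos_le_one _)
  simpa [sinQuot_zero_right] using this

theorem sinQuot_sub_le {ω ω' x b : ℝ} (h : ω' ≤ ω) (hx : 0 ≤ x) (hxb : x ≤ b) :
    sinQuot ω' x - sinQuot ω x ≤ (ω - ω') * b ^ 2 := by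
  have := sub_le_mul_of_hasDerivAt (C := (ω - ω') * b)
    (fun y => (hasDerivAt_sinQuot ω' y).sub (hasDerivAt_sinQuot ω y)) hx (by
      intro y hy
      have h1 : |Real.cos (ω' * y) - Real.cos (ω * y)| ≤ |ω' * y - ω * y| :=
        Real.abs_cos_sub_cos_le _ _
      have h2 : |ω' * y - ω * y| = (ω - ω') * y := by
        rw [abs_sub_comm, ← sub_mul, abs_of_nonneg (mul_nonneg (sub_nonneg.2 h) hy.1)]
      have h3 : (ω - ω') * y ≤ (ω - ω') * b :=
        mul_le_mul_of_nonneg_left (hy.2.trans hxb) (sub_nonneg.2 h)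
      linarith [le_abs_self (Real.cos (ω' * y) - Real.cos (ω * y))])
  simp only [Pi.sub_apply, sinQuot_zero_right, sub_zero] at this
  have h4 : (ω - ω') * b * x ≤ (ω - ω') * b * b :=
    mul_le_mul_of_nonneg_left hxb (mul_nonneg (sub_nonneg.2 h) (hx.trans hxb))
  nlinarith

theorem le_sinhQuot (ω : ℝ) {x : ℝ} (hx : 0 ≤ x) : x ≤ sinhQuot ω x := by
  have := mul_sub_le_of_hasDerivAt (hasDerivAt_sinhQuot ω) (C := 1) hx
    (fun y _ => Real.one_le_cosh _)
  simpa [sinhQuot_zero_right] using this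

theorem sinhQuot_le {ω Ω x : ℝ} (hω : 0 ≤ ω) (h : ω ≤ Ω) (hx : 0 ≤ x) :
    sinhQuot ω x ≤ Real.cosh (Ω * x) * x := by
  have := sub_le_mul_of_hasDerivAt (hasDerivAt_sinhQuot ω) (C := Real.cosh (Ω * x)) hx (by
    intro y hy
    rw [Real.cosh_le_cosh, abs_of_nonneg (mul_nonneg hω hy.1),
      abs_of_nonneg (mul_nonneg (hω.trans h) hx)]
    exact mul_le_mul h hy.2 hy.1 (hω.trans h))
  simpa [sinhQuot_zero_right] using this

theorem sinhQuot_sub_le {ω ω' Ω x : ℝ} (hω' : 0 ≤ ω') (h : ω' ≤ ω) (hΩ : ω ≤ Ω) (hx : 0 ≤ x) :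
    sinhQuot ω x - sinhQuot ω' x ≤ (ω - ω') * (Real.sinh (Ω * x) * x ^ 2) := by
  have hω := hω'.trans h
  have := sub_le_mul_of_hasDerivAt (C := (ω - ω') * (Real.sinh (Ω * x) * x))
    (fun y => (hasDerivAt_sinhQuot ω y).sub (hasDerivAt_sinhQuot ω' y)) hx (by
      intro y hy
      have h1 := sub_le_mul_of_hasDerivAt (C := Real.sinh (Ω * x)) Real.hasDerivAt_cosh
        (mul_le_mul_of_nonneg_right h hy.1) (by
          intro v hv
          exact Real.sinh_le_sinh.2 (hv.2.trans
            (mul_le_mul hΩ hy.2 hy.1 (hω.trans hΩ))))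
      have h2 : 0 ≤ Real.sinh (Ω * x) := Real.sinh_nonneg_iff.2 (mul_nonneg (hω.trans hΩ) hx)
      have h3 : Real.sinh (Ω * x) * (ω * y - ω' * y) ≤ (ω - ω') * (Real.sinh (Ω * x) * x) := by
        have : 0 ≤ Real.sinh (Ω * x) * (ω - ω') := mul_nonneg h2 (sub_nonneg.2 h)
        nlinarith [hy.2]
      linarith)
  simp only [Pi.sub_apply, sinhQuot_zero_right, sub_zero] at this
  linarith

/-- On the outer half of an annulus, an inequality between the quotients
`sinQuot / sinhQuot` controls the displacement linearly in the change of the modulus. -/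
theorem exists_sub_le_of_sinQuot_mul_le {Ω b : ℝ} (hΩ : 0 ≤ Ω) (hb : 0 < b)
    (hΩb : Ω * b < Real.pi / 2) :
    ∃ C : ℝ, 0 ≤ C ∧ ∀ ω ω' x x' : ℝ, 0 ≤ ω' → ω' ≤ ω → ω ≤ Ω → 0 < x → x ≤ b → 0 < x' →
      sinQuot ω x * sinhQuot ω' Real.pi ≤ sinQuot ω' x' * sinhQuot ω Real.pi →
      x - x' ≤ C * (ω - ω') := by
  have hcos : 0 < Real.cos (Ω * b) :=
    Real.cos_pos_of_mem_Ioo ⟨by have := mul_nonneg hΩ hb.le; linarith [Real.pi_pos], hΩb⟩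
  -- `c` bounds the slope of `sinQuot ω'` from below on `[0, b]`; `A` bounds `sinhQuot ω π`, and `B`
  -- is a Lipschitz constant for it in `ω`, for `0 ≤ ω ≤ Ω`.
  set c := Real.cos (Ω * b)
  set A := Real.cosh (Ω * Real.pi) * Real.pi
  set B := Real.sinh (Ω * Real.pi) * Real.pi ^ 2
  have hA : 0 ≤ A := by positivity
  have hB : 0 ≤ B := mul_nonneg (Real.sinh_nonneg_iff.2 (by positivity)) (by positivity)
  refine ⟨(b ^ 2 * A + b * B) / (c * Real.pi), by positivity, ?_⟩
  intro ω ω' x x' hω' hωω hωΩ hx hxb hx' hle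
  have hδ : 0 ≤ ω - ω' := sub_nonneg.2 hωω
  rcases le_or_gt x x' with h | h
  · have : 0 ≤ (b ^ 2 * A + b * B) / (c * Real.pi) * (ω - ω') := by positivity
    linarith
  have hω := hω'.trans hωω
  have h1 : c * (x - x') ≤ sinQuot ω' x - sinQuot ω' x' := by
    refine mul_sub_le_of_hasDerivAt (hasDerivAt_sinQuot ω') h.le fun y hy => ?_
    have hy0 : 0 ≤ y := hx'.le.trans hy.1
    refine Real.cos_le_cos_of_nonneg_of_le_pi (mul_nonneg hω' hy0) (by linarith [Real.pi_pos]) ?_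
    exact mul_le_mul (hωω.trans hωΩ) (hy.2.trans hxb) hy0 hΩ
  have h2 := sinQuot_sub_le hωω hx.le hxb
  have h3 : sinQuot ω x ≤ b := (sinQuot_le_self hx.le).trans hxb
  have h4 := le_sinhQuot ω Real.pi_pos.le
  have h5 := sinhQuot_le hω hωΩ Real.pi_pos.le
  have h6 := sinhQuot_sub_le hω' hωω hωΩ Real.pi_pos.le
  have h7 : 0 ≤ sinQuot ω x := by
    have : ω * x < Real.pi := by
      have := mul_le_mul hωΩ hxb hx.le hΩ
      linarith [Real.pi_pos]
    exact (sinQuot_pos hω hx this).le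
  rw [div_mul_eq_mul_div, le_div_iff₀ (by positivity)]
  calc (x - x') * (c * Real.pi) = c * (x - x') * Real.pi := by ring
    _ ≤ c * (x - x') * sinhQuot ω Real.pi := by
        have : 0 ≤ c * (x - x') := mul_nonneg hcos.le (sub_nonneg.2 h.le)
        gcongr
    _ ≤ (sinQuot ω' x - sinQuot ω' x') * sinhQuot ω Real.pi := by
        have := Real.pi_pos.le.trans h4
        gcongr
    -- The hypothesis `hle` enters here, leaving only differences in `ω`.
    _ ≤ (sinQuot ω' x - sinQuot ω x) * sinhQuot ω Real.pi +
          sinQuot ω x * (sinhQuot ω Real.pi - sinhQuot ω' Real.pi) := by linarith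
    _ ≤ ((ω - ω') * b ^ 2) * A + b * ((ω - ω') * B) := by
        have e1 : (sinQuot ω' x - sinQuot ω x) * sinhQuot ω Real.pi ≤ ((ω - ω') * b ^ 2) * A := by
          have := Real.pi_pos.le.trans h4
          calc _ ≤ ((ω - ω') * b ^ 2) * sinhQuot ω Real.pi := by gcongr
            _ ≤ _ := by gcongr
        have e2 : sinQuot ω x * (sinhQuot ω Real.pi - sinhQuot ω' Real.pi) ≤
            b * ((ω - ω') * B) := by
          calc _ ≤ sinQuot ω x * ((ω - ω') * B) := by gcongr
            _ ≤ _ := by gcongr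
        linarith
    _ = (b ^ 2 * A + b * B) * (ω - ω') := by ring

/-- The reflection `x ↦ π / ω - x` exchanges the two boundary circles and carries outer-half
estimates to the inner half. -/
theorem sinQuot_pi_div_sub {ω : ℝ} (hω : 0 < ω) (x : ℝ) :
    sinQuot ω (Real.pi / ω - x) = sinQuot ω x := by
  unfold sinQuot
  rw [if_neg hω.ne', if_neg hω.ne', mul_sub, mul_div_cancel₀ _ hω.ne', Real.sin_pi_sub]

/-- A Harnack type estimate on a disk. -/
theorem norm_sub_one_le_of_norm_le {q : ℂ → ℂ} {c : ℂ} {R M : ℝ} (hR : 0 < R)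
    (hq : DifferentiableOn ℂ q (Metric.ball c R)) (hM : 1 ≤ M)
    (hqM : ∀ z ∈ Metric.ball c R, ‖q z‖ ≤ M) {z : ℂ} (hz : z ∈ Metric.ball c (R / 2)) :
    ‖q z - 1‖ ≤ 4 * (M - 1) + 3 * ‖q c - 1‖ := by
  -- Since `Re q ≤ |q| ≤ M`, this function has non-positive real part, so Borel–Carathéodory bounds
  -- it by its value at the centre.
  let p : ℂ → ℂ := fun ζ => q (c + ζ) - M
  have hmem : ∀ ζ ∈ Metric.ball (0 : ℂ) R, c + ζ ∈ Metric.ball c R := by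
    intro ζ hζ; simpa using hζ
  have hp : DifferentiableOn ℂ p (Metric.ball 0 R) :=
    (hq.comp (by fun_prop) hmem).sub_const _
  have hpre : ∀ ζ ∈ Metric.ball (0 : ℂ) R, (p ζ).re ≤ 0 := by
    intro ζ hζ
    have := (re_le_norm (q (c + ζ))).trans (hqM _ (hmem ζ hζ))
    simp only [p, sub_re, ofReal_re]
    linarith
  have hzn : ‖z - c‖ < R / 2 := by simpa [dist_eq_norm] using hz
  have hzb : z - c ∈ Metric.ball (0 : ℂ) R := by
    rw [mem_ball_zero_iff]; linarith
  have hden : 0 < R - ‖z - c‖ := by linarith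
  have hbound : ‖p (z - c)‖ ≤ 3 * ‖p 0‖ := by
    -- The bound on the real part must be strictly positive, hence `ε`. The factor `3` is `(R + R/2)
    -- / (R - R/2)`.
    have h1 : ∀ ε > 0, ‖p (z - c)‖ ≤ 2 * ε + 3 * ‖p 0‖ := by
      intro ε hε
      refine (borelCaratheodory hε hp (fun ζ hζ => (hpre ζ hζ).trans hε.le) hR hzb).trans ?_
      have e1 : 2 * ε * ‖z - c‖ / (R - ‖z - c‖) ≤ 2 * ε := by
        rw [div_le_iff₀ hden]; nlinarith
      have e2 : ‖p 0‖ * (R + ‖z - c‖) / (R - ‖z - c‖) ≤ 3 * ‖p 0‖ := by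
        rw [div_le_iff₀ hden]; nlinarith [norm_nonneg (p 0)]
      linarith
    refine le_of_forall_pos_le_add fun ε hε => ?_
    have := h1 (ε / 2) (by positivity)
    linarith
  have hM1 : ‖(M : ℂ) - 1‖ = M - 1 := by
    rw [← ofReal_one, ← ofReal_sub, norm_real, Real.norm_of_nonneg (by linarith)]
  have h2 : ‖p 0‖ ≤ ‖q c - 1‖ + (M - 1) := by
    have : p 0 = (q c - 1) - ((M : ℂ) - 1) := by simp [p]
    rw [this, ← hM1]
    exact norm_sub_le _ _
  have h3 : ‖q z - 1‖ ≤ ‖p (z - c)‖ + (M - 1) := by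
    have : q z - 1 = p (z - c) + ((M : ℂ) - 1) := by simp [p]
    rw [this, ← hM1]
    exact norm_add_le _ _
  linarith

/-! ### Non-negative densities of class `L^d` -/

/-- Non-negative functions of class `L^d` on `[S, T]`. -/
def IsDensity (d : ℝ≥0∞) (S T : ℝ) (k : ℝ → ℝ) : Prop :=
  (∀ ξ ∈ Icc S T, 0 ≤ k ξ) ∧ MemLp k d (volume.restrict (Icc S T))

namespace IsDensity

variable {d : ℝ≥0∞} {S T : ℝ} {k l : ℝ → ℝ}

theorem zero : IsDensity d S T (fun _ => 0) := ⟨fun _ _ => le_rfl, MemLp.zero⟩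

theorem add (hk : IsDensity d S T k) (hl : IsDensity d S T l) :
    IsDensity d S T (fun ξ => k ξ + l ξ) :=
  ⟨fun ξ hξ => add_nonneg (hk.1 ξ hξ) (hl.1 ξ hξ), hk.2.add hl.2⟩

theorem const_mul {c : ℝ} (hc : 0 ≤ c) (hk : IsDensity d S T k) :
    IsDensity d S T (fun ξ => c * k ξ) :=
  ⟨fun ξ hξ => mul_nonneg hc (hk.1 ξ hξ), hk.2.const_mul c⟩

theorem integrableOn (hd : 1 ≤ d) (hk : IsDensity d S T k) : IntegrableOn k (Icc S T) :=
  hk.2.integrable hd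

theorem intervalIntegrable (hd : 1 ≤ d) (hk : IsDensity d S T k) {u t : ℝ} (hu : u ∈ Icc S T)
    (ht : t ∈ Icc S T) : IntervalIntegrable k volume u t := by
  refine ((hk.integrableOn hd).mono_set ?_).intervalIntegrable
  exact uIcc_subset_Icc hu ht

theorem integral_nonneg (hk : IsDensity d S T k) {u t : ℝ} (hu : S ≤ u) (hut : u ≤ t)
    (ht : t ≤ T) : 0 ≤ ∫ ξ in u..t, k ξ :=
  intervalIntegral.integral_nonneg hut fun ξ hξ => hk.1 ξ ⟨hu.trans hξ.1, hξ.2.trans ht⟩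

theorem integral_add (hd : 1 ≤ d) (hk : IsDensity d S T k) (hl : IsDensity d S T l) {u t : ℝ}
    (hu : u ∈ Icc S T) (ht : t ∈ Icc S T) :
    ∫ ξ in u..t, (k ξ + l ξ) = (∫ ξ in u..t, k ξ) + ∫ ξ in u..t, l ξ :=
  intervalIntegral.integral_add (hk.intervalIntegrable hd hu ht) (hl.intervalIntegrable hd hu ht)

theorem integral_adjacent (hd : 1 ≤ d) (hk : IsDensity d S T k) {u v t : ℝ}
    (hu : u ∈ Icc S T) (hv : v ∈ Icc S T) (ht : t ∈ Icc S T) :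
    (∫ ξ in u..v, k ξ) + ∫ ξ in v..t, k ξ = ∫ ξ in u..t, k ξ :=
  intervalIntegral.integral_add_adjacent_intervals (hk.intervalIntegrable hd hu hv)
    (hk.intervalIntegrable hd hv ht)

theorem indicator {S' : ℝ} (hS : S ≤ S') (hk : IsDensity d S' T k) :
    IsDensity d S T ((Icc S' T).indicator k) := by
  refine ⟨fun ξ _ => indicator_nonneg hk.1 ξ, ?_⟩
  rw [memLp_indicator_iff_restrict measurableSet_Icc, Measure.restrict_restrict measurableSet_Icc,
    inter_eq_left.2 (Icc_subset_Icc_left hS)]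
  exact hk.2

theorem integral_indicator {S' u t : ℝ} (hu : S' ≤ u) (hut : u ≤ t) (ht : t ≤ T) :
    ∫ ξ in u..t, (Icc S' T).indicator k ξ = ∫ ξ in u..t, k ξ := by
  refine intervalIntegral.integral_congr fun ξ hξ => ?_
  rw [uIcc_of_le hut] at hξ
  have hmem : ξ ∈ Icc S' T := ⟨hu.trans hξ.1, hξ.2.trans ht⟩
  exact indicator_of_mem hmem k

theorem tendsto_integral (hd : 1 ≤ d) (hk : IsDensity d S T k) {τ σ : ℝ} (hτ : τ ∈ Icc S T)
    (hσ : σ ∈ Icc S T) :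
    Tendsto (fun p : ℝ × ℝ => ∫ ξ in p.1..p.2, k ξ) (𝓝[Icc S T] τ ×ˢ 𝓝[Icc S T] σ)
      (𝓝 (∫ ξ in τ..σ, k ξ)) := by
  have hST : S ≤ T := hτ.1.trans hτ.2
  have hS : S ∈ Icc S T := left_mem_Icc.2 hST
  have hc : ContinuousOn (fun x => ∫ ξ in S..x, k ξ) (Icc S T) := by
    have := intervalIntegral.continuousOn_primitive_interval (a := S) (b := T) (f := k)
      (μ := volume) (by rw [uIcc_of_le hST]; exact hk.integrableOn hd)
    rwa [uIcc_of_le hST] at this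
  have h1 := ((hc σ hσ).tendsto.comp (tendsto_snd (f := 𝓝[Icc S T] τ))).sub
    ((hc τ hτ).tendsto.comp (tendsto_fst (g := 𝓝[Icc S T] σ)))
  have e : ∀ a ∈ Icc S T, ∀ b ∈ Icc S T,
      (∫ ξ in S..b, k ξ) - (∫ ξ in S..a, k ξ) = ∫ ξ in a..b, k ξ := by
    intro a ha b hb
    rw [← hk.integral_adjacent hd hS ha hb]; ring
  rw [e τ hτ σ hσ] at h1
  refine h1.congr' ?_
  filter_upwards [prod_mem_prod self_mem_nhdsWithin self_mem_nhdsWithin] with p hp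
  exact e _ hp.1 _ hp.2

end IsDensity

/-! ### Local estimates for evolution families -/

theorem exists_ball_eventually {α : Type*} {l : Filter α} {w₀ : ℂ} {P : α → ℂ → Prop}
    (h : ∀ᶠ p : α × ℂ in l ×ˢ 𝓝 w₀, P p.1 p.2) :
    ∃ R > 0, ∀ᶠ p in l, ∀ w ∈ Metric.ball w₀ R, P p w := by
  obtain ⟨pa, ha, pb, hb, hab⟩ := eventually_prod_iff.1 h
  obtain ⟨R, hR, hball⟩ := Metric.eventually_nhds_iff_ball.1 hb
  exact ⟨R, hR, ha.mono fun p hp w hw => hab hp (hball w hw)⟩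

theorem eventually_forall_of_local {α : Type*} {l : Filter α} {K : Set ℂ} (hK : IsCompact K)
    {P : α → ℂ → Prop}
    (h : ∀ w₀ ∈ K, ∃ R > 0, ∀ᶠ p in l, ∀ w ∈ Metric.ball w₀ R, P p w) :
    ∀ᶠ p in l, ∀ w ∈ K, P p w := by
  refine hK.induction_on (p := fun V => ∀ᶠ p in l, ∀ w ∈ V, P p w) (by simp)
    (fun s t hst ht => ht.mono fun p hp w hw => hp w (hst hw)) ?_ ?_
  · intro s t hs ht
    filter_upwards [hs, ht] with p h1 h2 w hw
    exact hw.elim (h1 w) (h2 w)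
  · intro w hw
    obtain ⟨R, hR, hw⟩ := h w hw
    exact ⟨_, mem_nhdsWithin_of_mem_nhds (Metric.ball_mem_nhds _ hR), hw⟩

/-- The pairs of times of `[S, T]` close to `τ`. -/
def timePairs (S T τ : ℝ) : Filter (ℝ × ℝ) := 𝓝[Icc S T] τ ×ˢ 𝓝[Icc S T] τ

theorem eventually_mem_timePairs (S T τ : ℝ) :
    ∀ᶠ p in timePairs S T τ, p.1 ∈ Icc S T ∧ p.2 ∈ Icc S T :=
  prod_mem_prod self_mem_nhdsWithin self_mem_nhdsWithin

/-- The increments of an evolution family at times near `τ` are dominated near `w₀` by the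
integral of a single density. -/
def HasLocalDensity (d : ℝ≥0∞) (φ : ℝ → ℝ → ℂ → ℂ) (S T τ : ℝ) (w₀ : ℂ) : Prop :=
  ∃ k, IsDensity d S T k ∧ ∃ R > 0, ∀ᶠ p in timePairs S T τ, p.1 ≤ p.2 →
    ∀ w ∈ Metric.ball w₀ R, ‖φ p.1 p.2 w - w‖ ≤ ∫ ξ in p.1..p.2, k ξ

section

variable {d : ℝ≥0∞} {r : ℝ → ℝ} {φ : ℝ → ℝ → ℂ → ℂ} {S T : ℝ}

theorem IsCanonicalSystem.continuousOn_omega (hr : IsCanonicalSystem d r) (hS : 0 ≤ S) :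
    ContinuousOn (fun t => omega (r t)) (Icc S T) := by
  rcases le_or_gt S T with h | h
  · have := (hr.omega_ac S T h fun x hx => hS.trans hx.1).1.continuousOn
    rwa [uIcc_of_le h] at this
  · simp [h]

theorem IsCanonicalSystem.exists_density (hr : IsCanonicalSystem d r) (hS : 0 ≤ S)
    (hST : S ≤ T) : ∃ g, IsDensity d S T g ∧ ∀ u t, S ≤ u → u ≤ t → t ≤ T →
      omega (r u) - omega (r t) ≤ ∫ ξ in u..t, g ξ := by
  have hac := hr.omega_ac S T hST fun x hx => hS.trans hx.1
  refine ⟨fun ξ => ‖deriv (fun t => omega (r t)) ξ‖, ⟨fun _ _ => norm_nonneg _, hac.2.norm⟩, ?_⟩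
  intro u t hu hut ht
  have h1 : AbsolutelyContinuousOnInterval (fun t => omega (r t)) u t := by
    refine hac.1.mono ?_
    rw [uIcc_of_le hut, uIcc_of_le hST]
    exact Icc_subset_Icc hu ht
  have h2 := h1.integral_deriv_eq_sub
  have h3 := intervalIntegral.norm_integral_le_integral_norm (μ := volume)
    (f := deriv fun t => omega (r t)) hut
  rw [h2, Real.norm_eq_abs] at h3
  linarith [neg_abs_le (omega (r t) - omega (r u))]

theorem IsCanonicalSystem.annulus_subset (hr : IsCanonicalSystem d r) {u t : ℝ} (hu : 0 ≤ u)
    (hut : u ≤ t) : annulus (r u) ⊆ annulus (r t) := by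
  intro z hz
  have ht := hu.trans hut
  rw [mem_annulus_iff (hr.radius_mem u hu)] at hz
  rw [mem_annulus_iff (hr.radius_mem t ht)]
  refine ⟨hz.1, hz.2.1, lt_of_le_of_lt ?_ hz.2.2⟩
  have : 0 ≤ -Real.log ‖z‖ := by
    have := Real.log_nonpos (norm_nonneg z) hz.2.1.le; linarith
  exact mul_le_mul_of_nonneg_right (hr.omega_antitone hu ht hut) this

theorem IsCanonicalSystem.eventually_mem (hr : IsCanonicalSystem d r) (hS : 0 ≤ S) {τ : ℝ}
    (hτ : τ ∈ Icc S T) {w₀ : ℂ} (hw₀ : w₀ ∈ annulus (r τ)) :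
    ∀ᶠ p : ℝ × ℂ in 𝓝[Icc S T] τ ×ˢ 𝓝 w₀, p.2 ∈ annulus (r p.1) := by
  have hw := (mem_annulus_iff (hr.radius_mem τ (hS.trans hτ.1))).1 hw₀
  have h1 : Tendsto (fun p : ℝ × ℂ => omega (r p.1)) (𝓝[Icc S T] τ ×ˢ 𝓝 w₀)
      (𝓝 (omega (r τ))) :=
    (hr.continuousOn_omega hS τ hτ).tendsto.comp tendsto_fst
  have h2 : Tendsto (fun p : ℝ × ℂ => p.2) (𝓝[Icc S T] τ ×ˢ 𝓝 w₀) (𝓝 w₀) := tendsto_snd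
  have h3 := h1.mul ((h2.norm.log (norm_ne_zero_iff.2 hw.1)).neg)
  filter_upwards [h2.eventually_ne hw.1, h2.norm.eventually_lt_const hw.2.1,
    h3.eventually_lt_const hw.2.2,
    (tendsto_fst (f := 𝓝[Icc S T] τ) (g := 𝓝 w₀)).eventually self_mem_nhdsWithin]
    with p e1 e2 e3 e4
  exact (mem_annulus_iff (hr.radius_mem _ (hS.trans e4.1))).2 ⟨e1, e2, e3⟩

/-- The image lies in the unit disk, hence within distance `2` of `f w₀`, and the Schwarz lemma
applies. The constant does not depend on `f`, which makes the family equicontinuous. -/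
theorem norm_sub_le_of_ball_subset {f : ℂ → ℂ} {ρ ρ' : ℝ} {w₀ w : ℂ} {R : ℝ}
    (hf : DifferentiableOn ℂ f (annulus ρ)) (hm : MapsTo f (annulus ρ) (annulus ρ'))
    (hR : Metric.ball w₀ R ⊆ annulus ρ) (hw : w ∈ Metric.ball w₀ R) :
    ‖f w - f w₀‖ ≤ 2 / R * ‖w - w₀‖ := by
  have h0 : w₀ ∈ Metric.ball w₀ R := Metric.mem_ball_self (Metric.nonempty_ball.1 ⟨w, hw⟩)
  have := Complex.dist_le_div_mul_dist_of_mapsTo_ball (R₂ := 2) (hf.mono hR) (fun z hz => by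
    have h1 := (hm (hR hz)).2
    have h2 := (hm (hR h0)).2
    rw [Metric.mem_closedBall, dist_eq_norm]
    exact (norm_sub_le _ _).trans (by linarith)) hw
  simpa [dist_eq_norm] using this

/-- Axiom (EF3) needs `w₀` in the domain at the initial time. By continuity of `ω`, `w₀` already
lies in `D_{S'}` for some `S'` slightly before `τ` (or `S' = S`), and (EF3) on `[S', T]` with
coinciding first two times bounds `φ s t w₀ - w₀`. -/
theorem IsEvolutionFamily.exists_density_at (hr : IsCanonicalSystem d r)
    (hφ : IsEvolutionFamily d r φ) (hS : 0 ≤ S) {τ : ℝ} (hτ : τ ∈ Icc S T) {w₀ : ℂ}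
    (hw₀ : w₀ ∈ annulus (r τ)) :
    ∃ k, IsDensity d S T k ∧ ∀ᶠ p in timePairs S T τ, p.1 ≤ p.2 →
      ‖φ p.1 p.2 w₀ - w₀‖ ≤ ∫ ξ in p.1..p.2, k ξ := by
  obtain ⟨R, hR, hev⟩ := exists_ball_eventually (P := fun u w => w ∈ annulus (r u))
    (hr.eventually_mem hS hτ hw₀)
  have hev' : ∀ᶠ u in 𝓝[Icc S T] τ, w₀ ∈ annulus (r u) :=
    hev.mono fun u hu => hu w₀ (Metric.mem_ball_self hR)
  obtain ⟨ε, hε, hball⟩ := Metric.eventually_nhds_iff_ball.1 (eventually_nhdsWithin_iff.1 hev')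
  set S' := max S (τ - ε / 2) with hS'
  have hSS' : S ≤ S' := le_max_left _ _
  have hS'τ : S' ≤ τ := max_le hτ.1 (by linarith)
  have hS'T := hS'τ.trans hτ.2
  have hmem : w₀ ∈ annulus (r S') := by
    refine hball S' ?_ ⟨hSS', hS'T⟩
    rw [Metric.mem_ball, Real.dist_eq, abs_lt]
    constructor <;> linarith [le_max_right S (τ - ε / 2)]
  obtain ⟨k, hk0, hk, hkb⟩ := hφ.regular S' T (hS.trans hSS') hS'T w₀ hmem
  refine ⟨(Icc S' T).indicator k, IsDensity.indicator hSS' ⟨hk0, hk⟩, ?_⟩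
  have hge : ∀ᶠ u in 𝓝[Icc S T] τ, τ - ε / 2 ≤ u :=
    mem_nhdsWithin_of_mem_nhds (Ici_mem_nhds (by linarith))
  filter_upwards [eventually_mem_timePairs S T τ, tendsto_fst.eventually hge,
    tendsto_fst.eventually hev'] with p hp h1 h2 hle
  have hS'p : S' ≤ p.1 := max_le hp.1.1 h1
  rw [IsDensity.integral_indicator hS'p hle hp.2.2, norm_sub_rev]
  have := hkb p.1 p.1 p.2 hS'p le_rfl hle hp.2.2
  rwa [hφ.id_of_eq p.1 (hS.trans hp.1.1) w₀ h2] at this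

theorem IsEvolutionFamily.eventually_norm_sub_lt (hd : 1 ≤ d) (hr : IsCanonicalSystem d r)
    (hφ : IsEvolutionFamily d r φ) (hS : 0 ≤ S) {τ : ℝ} (hτ : τ ∈ Icc S T) {w₀ : ℂ}
    (hw₀ : w₀ ∈ annulus (r τ)) {η : ℝ} (hη : 0 < η) :
    ∃ R > 0, ∀ᶠ p in timePairs S T τ, ∀ w ∈ Metric.ball w₀ R, p.1 ≤ p.2 →
      w ∈ annulus (r p.1) ∧ ‖φ p.1 p.2 w - w‖ < η := by
  obtain ⟨R, hR, hev⟩ := exists_ball_eventually (P := fun u w => w ∈ annulus (r u))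
    (hr.eventually_mem hS hτ hw₀)
  obtain ⟨k, hk, hkb⟩ := hφ.exists_density_at hr hS hτ hw₀
  have hint : ∀ᶠ p in timePairs S T τ, ∫ ξ in p.1..p.2, k ξ < η / 3 := by
    have := hk.tendsto_integral hd hτ hτ
    rw [intervalIntegral.integral_same] at this
    exact this.eventually_lt_const (by positivity)
  -- The bound `η * R / 6` makes the Lipschitz term `2 / R * ‖w - w₀‖` less than `η / 3`.
  refine ⟨min R (min (η / 3) (η * R / 6)), by positivity, ?_⟩
  filter_upwards [eventually_mem_timePairs S T τ, tendsto_fst.eventually hev, hkb, hint]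
    with p hp h1 h2 h3 w hw hle
  have hwR : w ∈ Metric.ball w₀ R := Metric.ball_subset_ball (min_le_left _ _) hw
  have hwn : ‖w - w₀‖ < min (η / 3) (η * R / 6) := by
    rw [← dist_eq_norm]; exact lt_of_lt_of_le hw (min_le_right _ _)
  have hp0 := hS.trans hp.1.1
  refine ⟨h1 w hwR, ?_⟩
  have e1 := norm_sub_le_of_ball_subset (hφ.holomorphic p.1 p.2 hp0 hle)
    (hφ.mapsTo p.1 p.2 hp0 hle) h1 hwR
  have e2 : 2 / R * ‖w - w₀‖ < η / 3 := by
    calc 2 / R * ‖w - w₀‖ < 2 / R * (η * R / 6) :=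
          mul_lt_mul_of_pos_left (hwn.trans_le (min_le_right _ _)) (by positivity)
      _ = η / 3 := by field_simp; norm_num
  have e3 : ‖w - w₀‖ < η / 3 := hwn.trans_le (min_le_left _ _)
  have e4 := h2 hle
  calc ‖φ p.1 p.2 w - w‖ = ‖(φ p.1 p.2 w - φ p.1 p.2 w₀) + (φ p.1 p.2 w₀ - w₀) - (w - w₀)‖ := by
        congr 1; ring
    _ ≤ ‖φ p.1 p.2 w - φ p.1 p.2 w₀‖ + ‖φ p.1 p.2 w₀ - w₀‖ + ‖w - w₀‖ :=
        (norm_sub_le _ _).trans (by gcongr; exact norm_add_le _ _)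
    _ < η := by linarith

/-- A circle of radius `ρ` inside `D_τ` is compact, so for all close times it is moved by less than
`ρ`; this is the closeness that `sinQuot_mul_le` requires. -/
theorem IsEvolutionFamily.eventually_sinQuot_mul_le (hd : 1 ≤ d) (hr : IsCanonicalSystem d r)
    (hφ : IsEvolutionFamily d r φ) (hS : 0 ≤ S) {τ : ℝ} (hτ : τ ∈ Icc S T) :
    ∀ᶠ p in timePairs S T τ, p.1 ≤ p.2 → ∀ z ∈ annulus (r p.1),
      sinQuot (omega (r p.1)) (-Real.log ‖z‖) * sinhQuot (omega (r p.2)) Real.pi ≤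
        sinQuot (omega (r p.2)) (-Real.log ‖φ p.1 p.2 z‖) * sinhQuot (omega (r p.1)) Real.pi := by
  obtain ⟨hr0, hr1⟩ := hr.radius_mem τ (hS.trans hτ.1)
  obtain ⟨ρ, hρr, hρ1⟩ := exists_between hr1
  have hρ0 : 0 < ρ := hr0.trans_lt hρr
  have hsphere : ∀ w ∈ Metric.sphere (0 : ℂ) ρ, w ∈ annulus (r τ) := by
    intro w hw
    rw [mem_sphere_zero_iff_norm] at hw
    exact ⟨by rw [hw]; exact hρr, by rw [hw]; exact hρ1⟩
  have := eventually_forall_of_local (isCompact_sphere (0 : ℂ) ρ) fun w hw =>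
    hφ.eventually_norm_sub_lt hd hr hS hτ (hsphere w hw) hρ0
  filter_upwards [eventually_mem_timePairs S T τ, this] with p hp h hle z hz
  have hp0 := hS.trans hp.1.1
  refine sinQuot_mul_le (hr.radius_mem _ hp0) (hr.radius_mem _ (hp0.trans hle))
    (hφ.holomorphic _ _ hp0 hle) (hφ.mapsTo _ _ hp0 hle) hρ0 (h ρ ?_ hle).1
    (fun z hz => (h z ?_ hle).2) hz
  · simp [hρ0.le]
  · simpa using hz

end

/-! ### Displacement on a disk from a one-sided modulus bound -/

theorem norm_apply_sub_le_of_norm_apply_le {f : ℂ → ℂ} {w₀ w : ℂ} {R M : ℝ} (hR : 0 < R)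
    (hf : DifferentiableOn ℂ f (Metric.ball w₀ R)) (hM : 1 ≤ M)
    (h0 : ∀ z ∈ Metric.ball w₀ R, z ≠ 0) (hle : ∀ z ∈ Metric.ball w₀ R, ‖f z‖ ≤ M * ‖z‖)
    (hw : w ∈ Metric.ball w₀ (R / 2)) (hw1 : ‖w‖ ≤ 1) :
    ‖f w - w‖ ≤ 4 * (M - 1) + 3 * M * ‖f w₀ - w₀‖ / ‖w₀‖ := by
  have hw₀ := h0 w₀ (Metric.mem_ball_self hR)
  have hwne := h0 w (Metric.ball_subset_ball (by linarith) hw)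
  have key := norm_sub_one_le_of_norm_le (q := fun z => f z / z) hR
    (hf.div differentiableOn_id h0) hM (fun z hz => by
      rw [norm_div, div_le_iff₀ (norm_pos_iff.2 (h0 z hz))]; exact hle z hz) hw
  have e1 : ‖f w - w‖ ≤ ‖f w / w - 1‖ := by
    have : f w - w = w * (f w / w - 1) := by field_simp
    rw [this, norm_mul]
    exact mul_le_of_le_one_left (norm_nonneg _) hw1
  have e2 : ‖f w₀ / w₀ - 1‖ = ‖f w₀ - w₀‖ / ‖w₀‖ := by
    rw [← norm_div, sub_div, div_self hw₀]
  rw [e2] at key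
  -- The factor `M ≥ 1` is given away so that the bounds for `f z / z` and `z / f z` have the same
  -- form.
  have e3 : 3 * (‖f w₀ - w₀‖ / ‖w₀‖) ≤ 3 * M * ‖f w₀ - w₀‖ / ‖w₀‖ := by
    rw [mul_div_assoc]
    gcongr
    linarith
  linarith

theorem norm_apply_sub_le_of_le_norm_apply {f : ℂ → ℂ} {w₀ w : ℂ} {R M : ℝ} (hR : 0 < R)
    (hf : DifferentiableOn ℂ f (Metric.ball w₀ R)) (hM : 1 ≤ M)
    (h0 : ∀ z ∈ Metric.ball w₀ R, f z ≠ 0) (hle : ∀ z ∈ Metric.ball w₀ R, ‖z‖ ≤ M * ‖f z‖)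
    (hw₀ : w₀ ≠ 0) (hw : w ∈ Metric.ball w₀ (R / 2)) (hw1 : ‖f w‖ ≤ 1) :
    ‖f w - w‖ ≤ 4 * (M - 1) + 3 * M * ‖f w₀ - w₀‖ / ‖w₀‖ := by
  have hfw₀ := h0 w₀ (Metric.mem_ball_self hR)
  have hwne := h0 w (Metric.ball_subset_ball (by linarith) hw)
  have key := norm_sub_one_le_of_norm_le (q := fun z => z / f z) hR
    (differentiableOn_id.div hf h0) hM (fun z hz => by
      rw [norm_div, div_le_iff₀ (norm_pos_iff.2 (h0 z hz))]; exact hle z hz) hw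
  have e1 : ‖f w - w‖ ≤ ‖w / f w - 1‖ := by
    have : w - f w = f w * (w / f w - 1) := by field_simp
    rw [norm_sub_rev, this, norm_mul]
    exact mul_le_of_le_one_left (norm_nonneg _) hw1
  have e2 : ‖w₀ / f w₀ - 1‖ = ‖f w₀ - w₀‖ / ‖f w₀‖ := by
    rw [norm_sub_rev (f w₀), ← norm_div, sub_div, div_self hfw₀]
  rw [e2] at key
  have e3 : 3 * (‖f w₀ - w₀‖ / ‖f w₀‖) ≤ 3 * M * ‖f w₀ - w₀‖ / ‖w₀‖ := by
    rw [← mul_div_assoc, div_le_div_iff₀ (norm_pos_iff.2 hfw₀) (norm_pos_iff.2 hw₀)]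
    have := mul_le_mul_of_nonneg_left (hle w₀ (Metric.mem_ball_self hR))
      (mul_nonneg zero_le_three (norm_nonneg (f w₀ - w₀)))
    linarith
  linarith

theorem exp_sub_one_le {x B : ℝ} (hx : 0 ≤ x) (hB : x ≤ B) :
    Real.exp x - 1 ≤ Real.exp B * x := by
  have h1 := Real.add_one_le_exp (-x)
  have h2 : Real.exp x * Real.exp (-x) = 1 := by rw [← Real.exp_add]; simp
  have h3 : Real.exp x - 1 ≤ Real.exp x * x := by
    have := mul_le_mul_of_nonneg_left h1 (Real.exp_pos x).le
    linarith
  exact h3.trans (mul_le_mul_of_nonneg_right (Real.exp_le_exp.2 hB) hx)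

theorem exists_pos_add_mul_add_lt {a x c : ℝ} (h : a * x < c) :
    ∃ ε > 0, (a + ε) * (x + ε) < c := by
  have : Tendsto (fun ε : ℝ => (a + ε) * (x + ε)) (𝓝[>] 0) (𝓝 ((a + 0) * (x + 0))) := by
    have : Continuous fun ε : ℝ => (a + ε) * (x + ε) := by fun_prop
    exact (this.tendsto 0).mono_left nhdsWithin_le_nhds
  simp only [add_zero] at this
  obtain ⟨ε, h1, h2⟩ := ((this.eventually_lt_const h).and self_mem_nhdsWithin).exists
  exact ⟨ε, h2, h1⟩

/-! ### Local densities: outer half, inner half, middle circle -/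

section

variable {d : ℝ≥0∞} {r : ℝ → ℝ} {φ : ℝ → ℝ → ℂ → ℂ} {S T : ℝ}

theorem HasLocalDensity.exists_of_isCompact (hd : 1 ≤ d) {τ : ℝ} {K : Set ℂ} (hK : IsCompact K)
    (h : ∀ w ∈ K, HasLocalDensity d φ S T τ w) :
    ∃ k, IsDensity d S T k ∧ ∀ᶠ p in timePairs S T τ, p.1 ≤ p.2 →
      ∀ w ∈ K, ‖φ p.1 p.2 w - w‖ ≤ ∫ ξ in p.1..p.2, k ξ := by
  refine hK.induction_on (p := fun V => ∃ k, IsDensity d S T k ∧ ∀ᶠ p in timePairs S T τ,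
    p.1 ≤ p.2 → ∀ w ∈ V, ‖φ p.1 p.2 w - w‖ ≤ ∫ ξ in p.1..p.2, k ξ)
    ⟨_, IsDensity.zero, by simp⟩ ?_ ?_ ?_
  · rintro s t hst ⟨k, hk, hev⟩
    exact ⟨k, hk, hev.mono fun p hp hle w hw => hp hle w (hst hw)⟩
  · rintro s t ⟨k, hk, hev⟩ ⟨l, hl, hev'⟩
    refine ⟨_, hk.add hl, ?_⟩
    filter_upwards [hev, hev', eventually_mem_timePairs S T τ] with p h1 h2 hp hle w hw
    rw [hk.integral_add hd hl hp.1 hp.2]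
    have e1 := hk.integral_nonneg hp.1.1 hle hp.2.2
    have e2 := hl.integral_nonneg hp.1.1 hle hp.2.2
    rcases hw with hw | hw
    · have := h1 hle w hw
      linarith
    · have := h2 hle w hw
      linarith
  · intro w hw
    obtain ⟨k, hk, R, hR, hev⟩ := h w hw
    exact ⟨_, mem_nhdsWithin_of_mem_nhds (Metric.ball_mem_nhds _ hR), k, hk, hev⟩

/-- As `ω ≤ ω (r S)`, the factor `M` is bounded by a constant `B` and `M - 1` is at most `B * C`
times the decrease of `ω`. Both terms of the bound thus have densities that do not depend on `w`. -/
theorem IsEvolutionFamily.hasLocalDensity_of_norm_sub_le (hd : 1 ≤ d)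
    (hr : IsCanonicalSystem d r) (hφ : IsEvolutionFamily d r φ) (hS : 0 ≤ S) {τ : ℝ}
    (hτ : τ ∈ Icc S T) {w₀ : ℂ} (hw₀ : w₀ ∈ annulus (r τ)) {C R : ℝ} (hC : 0 ≤ C) (hR : 0 < R)
    (h : ∀ᶠ p in timePairs S T τ, p.1 ≤ p.2 → ∀ w ∈ Metric.ball w₀ R, ∀ M,
      M = Real.exp (C * (omega (r p.1) - omega (r p.2))) → 1 ≤ M →
      ‖φ p.1 p.2 w - w‖ ≤ 4 * (M - 1) + 3 * M * ‖φ p.1 p.2 w₀ - w₀‖ / ‖w₀‖) :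
    HasLocalDensity d φ S T τ w₀ := by
  have hST : S ≤ T := hτ.1.trans hτ.2
  obtain ⟨k, hk, hkb⟩ := hφ.exists_density_at hr hS hτ hw₀
  obtain ⟨g, hg, hgb⟩ := hr.exists_density hS hST
  set B := Real.exp (C * omega (r S))
  have hn : 0 ≤ 3 * B / ‖w₀‖ := by positivity
  refine ⟨_, (hg.const_mul (c := 4 * (B * C)) (by positivity)).add (hk.const_mul hn), R, hR, ?_⟩
  filter_upwards [h, hkb, eventually_mem_timePairs S T τ] with p h1 h2 hp hle w hw
  have hS1 := hr.omega_antitone hS (hS.trans hp.1.1) hp.1.1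
  have h21 := hr.omega_antitone (hS.trans hp.1.1) (hS.trans hp.2.1) hle
  have hpos := omega_nonneg (hr.radius_mem p.2 (hS.trans hp.2.1))
  simp only at hS1 h21
  set δ := omega (r p.1) - omega (r p.2) with hδ
  have hδ0 : 0 ≤ δ := sub_nonneg.2 h21
  have hCδ : C * δ ≤ C * omega (r S) := by gcongr; linarith
  have e1 := exp_sub_one_le (mul_nonneg hC hδ0) hCδ
  have e2 : Real.exp (C * δ) ≤ B := Real.exp_le_exp.2 hCδ
  have e3 := hgb p.1 p.2 hp.1.1 hle hp.2.2
  have e4 := h2 hle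
  refine (h1 hle w hw _ rfl (Real.one_le_exp (mul_nonneg hC hδ0))).trans ?_
  rw [(hg.const_mul (c := 4 * (B * C)) (by positivity)).integral_add hd (hk.const_mul hn) hp.1 hp.2,
    intervalIntegral.integral_const_mul, intervalIntegral.integral_const_mul]
  have e5 : 4 * (Real.exp (C * δ) - 1) ≤ 4 * (B * C) * ∫ ξ in p.1..p.2, g ξ := by
    calc 4 * (Real.exp (C * δ) - 1) ≤ 4 * (B * (C * δ)) := by linarith
      _ = 4 * (B * C) * δ := by ring
      _ ≤ _ := by gcongr
  have e6 : 3 * Real.exp (C * δ) * ‖φ p.1 p.2 w₀ - w₀‖ / ‖w₀‖ ≤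
      3 * B / ‖w₀‖ * ∫ ξ in p.1..p.2, k ξ := by
    calc 3 * Real.exp (C * δ) * ‖φ p.1 p.2 w₀ - w₀‖ / ‖w₀‖
        ≤ 3 * B * (∫ ξ in p.1..p.2, k ξ) / ‖w₀‖ := by gcongr
      _ = _ := by ring
  linarith

theorem neg_log_norm_pos {ρ : ℝ} (hρ : ρ ∈ Ico (0 : ℝ) 1) {z : ℂ} (hz : z ∈ annulus ρ) :
    0 < -Real.log ‖z‖ := by
  have hz := (mem_annulus_iff hρ).1 hz
  have := Real.log_neg (norm_pos_iff.2 hz.1) hz.2.1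
  linarith

theorem norm_le_exp_mul_norm {z w : ℂ} (hz : z ≠ 0) (hw : w ≠ 0) {c : ℝ}
    (h : Real.log ‖z‖ ≤ c + Real.log ‖w‖) : ‖z‖ ≤ Real.exp c * ‖w‖ := by
  rw [← Real.exp_log (norm_pos_iff.2 hz), ← Real.exp_log (norm_pos_iff.2 hw), ← Real.exp_add]
  exact Real.exp_le_exp.2 h

theorem tendsto_neg_log_norm {l : Filter ℝ} {w₀ : ℂ} (hw₀ : w₀ ≠ 0) :
    Tendsto (fun p : ℝ × ℂ => -Real.log ‖p.2‖) (l ×ˢ 𝓝 w₀) (𝓝 (-Real.log ‖w₀‖)) :=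
  ((tendsto_snd (f := l) (g := 𝓝 w₀)).norm.log (norm_ne_zero_iff.2 hw₀)).neg

/-- The strict inequality `ω x < π/2` leaves room `ε` for nearby times and points. There the loop
inequality yields `log |f z| ≤ log |z| + C (ω - ω')`, so `f z / z` is bounded by `M`. -/
theorem IsEvolutionFamily.hasLocalDensity_outer (hd : 1 ≤ d)
    (hr : IsCanonicalSystem d r) (hφ : IsEvolutionFamily d r φ) (hS : 0 ≤ S) {τ : ℝ}
    (hτ : τ ∈ Icc S T) {w₀ : ℂ} (hw₀ : w₀ ∈ annulus (r τ))
    (hx : omega (r τ) * (-Real.log ‖w₀‖) < Real.pi / 2) : HasLocalDensity d φ S T τ w₀ := by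
  have hrτ := hr.radius_mem τ (hS.trans hτ.1)
  have hx0 := neg_log_norm_pos hrτ hw₀
  have hω0 := omega_nonneg hrτ
  have hne := ((mem_annulus_iff hrτ).1 hw₀).1
  obtain ⟨ε, hε, hlt⟩ := exists_pos_add_mul_add_lt hx
  obtain ⟨C, hC, hCb⟩ := exists_sub_le_of_sinQuot_mul_le (by positivity) (by positivity) hlt
  have hω : ∀ᶠ u in 𝓝[Icc S T] τ, omega (r u) < omega (r τ) + ε :=
    (hr.continuousOn_omega hS τ hτ).eventually_lt_const (by linarith)
  obtain ⟨R, hR, hball⟩ := exists_ball_eventually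
    (P := fun u w => w ∈ annulus (r u) ∧ -Real.log ‖w‖ < -Real.log ‖w₀‖ + ε)
    ((hr.eventually_mem hS hτ hw₀).and
      ((tendsto_neg_log_norm hne).eventually_lt_const (by linarith)))
  refine hφ.hasLocalDensity_of_norm_sub_le hd hr hS hτ hw₀ hC (half_pos hR) ?_
  filter_upwards [hφ.eventually_sinQuot_mul_le hd hr hS hτ, eventually_mem_timePairs S T τ,
    tendsto_fst.eventually hω, tendsto_fst.eventually hball] with p h1 hp h2 h3 hle w hw M hM hM1
  have hp1 := hS.trans hp.1.1
  have hp2 := hS.trans hp.2.1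
  have hr1 := hr.radius_mem _ hp1
  have hr2 := hr.radius_mem _ hp2
  have hm := hφ.mapsTo p.1 p.2 hp1 hle
  have hwR : w ∈ Metric.ball w₀ R := Metric.ball_subset_ball (by linarith) hw
  refine norm_apply_sub_le_of_norm_apply_le hR
    ((hφ.holomorphic p.1 p.2 hp1 hle).mono fun z hz => (h3 z hz).1) hM1
    (fun z hz => ((mem_annulus_iff hr1).1 (h3 z hz).1).1) ?_ hw (h3 w hwR).1.2.le
  intro z hz
  have hza := (h3 z hz).1
  have := hCb _ _ _ _ (omega_nonneg hr2) (hr.omega_antitone hp1 hp2 hle) h2.le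
    (neg_log_norm_pos hr1 hza) (h3 z hz).2.le (neg_log_norm_pos hr2 (hm hza)) (h1 hle z hza)
  rw [hM]
  exact norm_le_exp_mul_norm ((mem_annulus_iff hr2).1 (hm hza)).1 ((mem_annulus_iff hr1).1 hza).1
    (by linarith)

theorem IsEvolutionFamily.hasLocalDensity_inner (hd : 1 ≤ d)
    (hr : IsCanonicalSystem d r) (hφ : IsEvolutionFamily d r φ) (hS : 0 ≤ S) {τ : ℝ}
    (hτ : τ ∈ Icc S T) {w₀ : ℂ} (hw₀ : w₀ ∈ annulus (r τ))
    (hx : Real.pi / 2 < omega (r τ) * (-Real.log ‖w₀‖)) : HasLocalDensity d φ S T τ w₀ := by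
  have hrτ := hr.radius_mem τ (hS.trans hτ.1)
  have hx0 := neg_log_norm_pos hrτ hw₀
  have hω0 : 0 < omega (r τ) := by
    refine lt_of_le_of_ne (omega_nonneg hrτ) fun h => ?_
    rw [← h, zero_mul] at hx
    linarith [Real.pi_pos]
  have hne := ((mem_annulus_iff hrτ).1 hw₀).1
  set y₀ := Real.pi / omega (r τ) - -Real.log ‖w₀‖ with hy₀
  have hy₀pos : 0 < y₀ := by
    have := ((mem_annulus_iff hrτ).1 hw₀).2.2
    rw [hy₀, sub_pos, lt_div_iff₀ hω0]
    linarith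
  have hy : omega (r τ) * y₀ < Real.pi / 2 := by
    rw [hy₀, mul_sub, mul_div_cancel₀ _ hω0.ne']
    linarith
  obtain ⟨ε, hε, hlt⟩ := exists_pos_add_mul_add_lt hy
  obtain ⟨C, hC, hCb⟩ := exists_sub_le_of_sinQuot_mul_le (by positivity) (by positivity) hlt
  have hcont := hr.continuousOn_omega hS τ hτ
  have hω : ∀ᶠ u in 𝓝[Icc S T] τ, omega (r u) < omega (r τ) + ε :=
    hcont.eventually_lt_const (by linarith)
  have hω' : ∀ᶠ u in 𝓝[Icc S T] τ, omega (r τ) / 2 < omega (r u) :=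
    hcont.eventually_const_lt (by linarith)
  have hdiff : Tendsto (fun p : ℝ × ℂ => Real.pi / omega (r p.1) - -Real.log ‖p.2‖)
      (𝓝[Icc S T] τ ×ˢ 𝓝 w₀) (𝓝 y₀) :=
    (tendsto_const_nhds.div (hcont.tendsto.comp tendsto_fst) hω0.ne').sub
      (tendsto_neg_log_norm hne)
  obtain ⟨R, hR, hball⟩ := exists_ball_eventually
    (P := fun u w => w ∈ annulus (r u) ∧ Real.pi / omega (r u) - -Real.log ‖w‖ < y₀ + ε)
    ((hr.eventually_mem hS hτ hw₀).and (hdiff.eventually_lt_const (by linarith)))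
  set m := omega (r τ) / 2 with hmdef
  have hm0 : 0 < m := half_pos hω0
  -- The reflected coordinate is `π / ω - x`. The extra `π / m ^ 2` pays for the change of `π / ω`
  -- itself, where `m` is a lower bound for `ω` at nearby times.
  refine hφ.hasLocalDensity_of_norm_sub_le hd hr hS hτ hw₀ (C := C + Real.pi / m ^ 2)
    (by positivity) (half_pos hR) ?_
  filter_upwards [hφ.eventually_sinQuot_mul_le hd hr hS hτ, eventually_mem_timePairs S T τ,
    tendsto_fst.eventually hω, tendsto_fst.eventually hω', tendsto_snd.eventually hω',
    tendsto_fst.eventually hball] with p h1 hp h2 h2' h2'' h3 hle w hw M hM hM1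
  have hp1 := hS.trans hp.1.1
  have hp2 := hS.trans hp.2.1
  have hr1 := hr.radius_mem _ hp1
  have hr2 := hr.radius_mem _ hp2
  have hm := hφ.mapsTo p.1 p.2 hp1 hle
  have hanti : omega (r p.2) ≤ omega (r p.1) := hr.omega_antitone hp1 hp2 hle
  have hwR : w ∈ Metric.ball w₀ R := Metric.ball_subset_ball (by linarith) hw
  have hpos1 : 0 < omega (r p.1) := hm0.trans h2'
  have hpos2 : 0 < omega (r p.2) := hm0.trans h2''
  have hgap : ∀ ρ ∈ Ico (0 : ℝ) 1, 0 < omega ρ → ∀ z ∈ annulus ρ,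
      0 < Real.pi / omega ρ - -Real.log ‖z‖ := by
    intro ρ hρ hpos z hz
    have := ((mem_annulus_iff hρ).1 hz).2.2
    rw [sub_pos, lt_div_iff₀ hpos]
    linarith
  refine norm_apply_sub_le_of_le_norm_apply hR
    ((hφ.holomorphic p.1 p.2 hp1 hle).mono fun z hz => (h3 z hz).1) hM1
    (fun z hz => ((mem_annulus_iff hr2).1 (hm (h3 z hz).1)).1) ?_ hne hw
    (hm (h3 w hwR).1).2.le
  intro z hz
  have hza := (h3 z hz).1
  have hineq := h1 hle z hza
  rw [← sinQuot_pi_div_sub hpos1, ← sinQuot_pi_div_sub hpos2] at hineq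
  have := hCb _ _ _ _ (omega_nonneg hr2) hanti h2.le
    (hgap _ hr1 hpos1 z hza) (h3 z hz).2.le (hgap _ hr2 hpos2 _ (hm hza)) hineq
  have e : Real.pi / omega (r p.2) - Real.pi / omega (r p.1) ≤
      Real.pi / m ^ 2 * (omega (r p.1) - omega (r p.2)) := by
    have e1 : Real.pi / omega (r p.2) - Real.pi / omega (r p.1) =
        Real.pi / (omega (r p.1) * omega (r p.2)) * (omega (r p.1) - omega (r p.2)) := by
      field_simp
    rw [e1, pow_two]
    have : 0 ≤ omega (r p.1) - omega (r p.2) := sub_nonneg.2 hanti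
    gcongr
  rw [hM]
  refine norm_le_exp_mul_norm ((mem_annulus_iff hr1).1 hza).1 ((mem_annulus_iff hr2).1 (hm hza)).1
    ?_
  linarith

theorem norm_le_on_closedAnnulus {g : ℂ → ℂ} {a b B : ℝ}
    (hg : DifferentiableOn ℂ g {z | a ≤ ‖z‖ ∧ ‖z‖ ≤ b})
    (hB : ∀ z ∈ Metric.sphere (0 : ℂ) a ∪ Metric.sphere 0 b, ‖g z‖ ≤ B) {w : ℂ}
    (hw1 : a < ‖w‖) (hw2 : ‖w‖ < b) : ‖g w‖ ≤ B := by
  set U : Set ℂ := {z | a < ‖z‖ ∧ ‖z‖ < b} with hU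
  have hUo : IsOpen U :=
    (isOpen_lt continuous_const continuous_norm).inter (isOpen_lt continuous_norm continuous_const)
  have hcl : closure U ⊆ {z | a ≤ ‖z‖ ∧ ‖z‖ ≤ b} := by
    refine closure_minimal (fun z hz => ⟨hz.1.le, hz.2.le⟩) ?_
    exact (isClosed_le continuous_const continuous_norm).inter
      (isClosed_le continuous_norm continuous_const)
  refine Complex.norm_le_of_forall_mem_frontier_norm_le (U := U) ?_
    (hg.mono hcl).diffContOnCl ?_ (subset_closure ⟨hw1, hw2⟩)
  · refine (Metric.isBounded_ball (x := (0 : ℂ)) (r := b)).subset fun z hz => ?_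
    exact mem_ball_zero_iff.2 hz.2
  · intro z hz
    rw [hUo.frontier_eq] at hz
    have h1 := hcl hz.1
    refine hB z ?_
    rw [mem_union, mem_sphere_zero_iff_norm, mem_sphere_zero_iff_norm]
    by_contra hcon
    rw [not_or] at hcon
    exact hz.2 ⟨lt_of_le_of_ne h1.1 (Ne.symm hcon.1), lt_of_le_of_ne h1.2 hcon.2⟩

theorem IsEvolutionFamily.hasLocalDensity (hd : 1 ≤ d)
    (hr : IsCanonicalSystem d r) (hφ : IsEvolutionFamily d r φ) (hS : 0 ≤ S) {τ : ℝ}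
    (hτ : τ ∈ Icc S T) {w₀ : ℂ} (hw₀ : w₀ ∈ annulus (r τ)) : HasLocalDensity d φ S T τ w₀ := by
  rcases lt_trichotomy (omega (r τ) * (-Real.log ‖w₀‖)) (Real.pi / 2) with hx | hx | hx
  · exact hφ.hasLocalDensity_outer hd hr hS hτ hw₀ hx
  swap
  · exact hφ.hasLocalDensity_inner hd hr hS hτ hw₀ hx
  have hrτ := hr.radius_mem τ (hS.trans hτ.1)
  have hx0 := neg_log_norm_pos hrτ hw₀
  have hne := ((mem_annulus_iff hrτ).1 hw₀).1
  set x₀ := -Real.log ‖w₀‖ with hx₀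
  -- On the middle circle `ω x₀ = π/2`, so the circles of radii `a` and `b` have `ω x` equal to
  -- `3π/4` and `π/4`: one in each half, with `w₀` between them.
  set a := Real.exp (-(3 / 2 * x₀)) with ha
  set b := Real.exp (-(x₀ / 2)) with hb
  have hwexp : ‖w₀‖ = Real.exp (-x₀) := by
    rw [hx₀, neg_neg, Real.exp_log (norm_pos_iff.2 hne)]
  have haw : a < ‖w₀‖ := by rw [hwexp]; exact Real.exp_lt_exp.2 (by linarith)
  have hwb : ‖w₀‖ < b := by rw [hwexp]; exact Real.exp_lt_exp.2 (by linarith)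
  have ha0 : 0 < a := Real.exp_pos _
  have hb1 : b < 1 := by rw [hb, Real.exp_lt_one_iff]; linarith
  have hab : a < b := haw.trans hwb
  have hloga : -Real.log a = 3 / 2 * x₀ := by rw [ha, Real.log_exp, neg_neg]
  have hlogb : -Real.log b = x₀ / 2 := by rw [hb, Real.log_exp, neg_neg]
  have hpi := Real.pi_pos
  have hcirc : ∀ z ∈ Metric.sphere (0 : ℂ) a ∪ Metric.sphere 0 b,
      HasLocalDensity d φ S T τ z := by
    rintro z (hz | hz)
    · rw [mem_sphere_zero_iff_norm] at hz
      refine hφ.hasLocalDensity_inner hd hr hS hτ ((mem_annulus_iff hrτ).2 ⟨?_, ?_, ?_⟩) ?_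
      · rw [← norm_pos_iff, hz]; exact ha0
      · rw [hz]; exact hab.trans hb1
      · rw [hz, hloga]; linarith
      · rw [hz, hloga]; linarith
    · rw [mem_sphere_zero_iff_norm] at hz
      refine hφ.hasLocalDensity_outer hd hr hS hτ ((mem_annulus_iff hrτ).2 ⟨?_, ?_, ?_⟩) ?_
      · rw [← norm_pos_iff, hz]; exact ha0.trans hab
      · rw [hz]; exact hb1
      · rw [hz, hlogb]; linarith
      · rw [hz, hlogb]; linarith
  obtain ⟨k, hk, hev⟩ := HasLocalDensity.exists_of_isCompact hd
    ((isCompact_sphere (0 : ℂ) a).union (isCompact_sphere 0 b)) hcirc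
  obtain ⟨R, hR, hball⟩ := Metric.mem_nhds_iff.1 (((isOpen_lt continuous_const
    continuous_norm).inter (isOpen_lt continuous_norm continuous_const)).mem_nhds
      (show w₀ ∈ {z : ℂ | a < ‖z‖} ∩ {z : ℂ | ‖z‖ < b} from ⟨haw, hwb⟩))
  have haτ : (a : ℂ) ∈ annulus (r τ) := by
    have hna : ‖(a : ℂ)‖ = a := by rw [norm_real, Real.norm_of_nonneg ha0.le]
    refine (mem_annulus_iff hrτ).2 ⟨by exact_mod_cast ha0.ne', ?_, ?_⟩
    · rw [hna]; exact hab.trans hb1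
    · rw [hna, hloga]; linarith
  obtain ⟨R', hR', hmem⟩ := exists_ball_eventually (P := fun u w => w ∈ annulus (r u))
    (hr.eventually_mem hS hτ haτ)
  refine ⟨k, hk, R, hR, ?_⟩
  filter_upwards [hev, tendsto_fst.eventually hmem, eventually_mem_timePairs S T τ]
    with p h1 h2 hp hle w hw
  have hsub : {z : ℂ | a ≤ ‖z‖ ∧ ‖z‖ ≤ b} ⊆ annulus (r p.1) := by
    intro z hz
    have := (h2 a (Metric.mem_ball_self hR')).1
    rw [norm_real, Real.norm_of_nonneg ha0.le] at this
    exact ⟨this.trans_le hz.1, hz.2.trans_lt hb1⟩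
  exact norm_le_on_closedAnnulus
    (((hφ.holomorphic p.1 p.2 (hS.trans hp.1.1) hle).mono hsub).sub differentiableOn_id)
    (h1 hle) (hball hw).1 (hball hw).2

end

/-! ### Joint continuity and the passage from local to global estimates -/

section

variable {d : ℝ≥0∞} {r : ℝ → ℝ} {φ : ℝ → ℝ → ℂ → ℂ} {S T : ℝ}

theorem isOpen_annulus (ρ : ℝ) : IsOpen (annulus ρ) :=
  (isOpen_lt continuous_const continuous_norm).inter (isOpen_lt continuous_norm continuous_const)

/-- The admissible triples `(s, u, z)` with `S ≤ s ≤ u ≤ T` and `z ∈ K`. -/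
def triples (S T : ℝ) (K : Set ℂ) : Set (ℝ × ℝ × ℂ) :=
  (Icc S T ×ˢ Icc S T ×ˢ K) ∩ {q | q.1 ≤ q.2.1}

theorem isCompact_triples (S T : ℝ) {K : Set ℂ} (hK : IsCompact K) :
    IsCompact (triples S T K) :=
  (isCompact_Icc.prod (isCompact_Icc.prod hK)).inter_right
    (isClosed_le continuous_fst (continuous_fst.comp continuous_snd))

/-- Continuity in both times at a fixed point. If `s' ≤ u`, then `φ s u z₀` is `φ s' u` applied to
the nearby point `φ s s' z₀`, and the Schwarz estimate applies; if `u < s'`, both values are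
compared with `z₀`. -/
theorem IsEvolutionFamily.norm_sub_le_of_le (hd : 1 ≤ d) (hr : IsCanonicalSystem d r)
    (hφ : IsEvolutionFamily d r φ) (hS : 0 ≤ S) {k : ℝ → ℝ} (hk : IsDensity d S T k) {z₀ : ℂ}
    {R : ℝ} (hR : 0 < R) (hball : Metric.ball z₀ R ⊆ annulus (r S))
    (hkb : ∀ s u t : ℝ, S ≤ s → s ≤ u → u ≤ t → t ≤ T →
      ‖φ s u z₀ - φ s t z₀‖ ≤ ∫ ξ in u..t, k ξ)
    {s s' u u' : ℝ} (hs : S ≤ s) (hss : s ≤ s') (hsu : s ≤ u) (hsu' : s' ≤ u') (hu : u ≤ T)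
    (hu' : u' ≤ T) (hsmall : ∫ ξ in s..s', k ξ < R) :
    ‖φ s u z₀ - φ s' u' z₀‖ ≤
      |∫ ξ in u..u', k ξ| + (1 + 2 / R) * |∫ ξ in s..s', k ξ| := by
  have hz₀ : ∀ v, S ≤ v → z₀ ∈ annulus (r v) := fun v hv =>
    hr.annulus_subset hS hv (hball (Metric.mem_ball_self hR))
  have h2R : 0 < 2 / R := by positivity
  have hs' := hs.trans hss
  have hs'T := hsu'.trans hu'
  have hid : ∀ v, S ≤ v → φ v v z₀ = z₀ := fun v hv => hφ.id_of_eq v (hS.trans hv) _ (hz₀ v hv)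
  have hmove : ∀ v t, S ≤ v → v ≤ t → t ≤ T → ‖φ v t z₀ - z₀‖ ≤ ∫ ξ in v..t, k ξ := by
    intro v t hv hvt ht
    have := hkb v v t hv le_rfl hvt ht
    rwa [hid v hv, norm_sub_rev] at this
  rcases le_or_gt s' u with h | h
  · have e1 := hmove s s' hs hss hs'T
    have hin : φ s s' z₀ ∈ Metric.ball z₀ R := by
      rw [Metric.mem_ball, dist_eq_norm]; exact e1.trans_lt hsmall
    have e2 := norm_sub_le_of_ball_subset (hφ.holomorphic s' u (hS.trans hs') h)
      (hφ.mapsTo s' u (hS.trans hs') h) (hball.trans (hr.annulus_subset hS hs')) hin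
    rw [← hφ.comp s s' u (hS.trans hs) hss h z₀ (hz₀ s hs)] at e2
    have e3 : ‖φ s' u z₀ - φ s' u' z₀‖ ≤ |∫ ξ in u..u', k ξ| := by
      rcases le_total u u' with h' | h'
      · exact (hkb s' u u' hs' h h' hu').trans (le_abs_self _)
      · rw [norm_sub_rev, intervalIntegral.integral_symm, abs_neg]
        exact (hkb s' u' u hs' hsu' h' hu).trans (le_abs_self _)
    have e4 : 2 / R * ‖φ s s' z₀ - z₀‖ ≤ 2 / R * |∫ ξ in s..s', k ξ| := by
      gcongr
      exact e1.trans (le_abs_self _)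
    have e5 := norm_sub_le_norm_sub_add_norm_sub (φ s u z₀) (φ s' u z₀) (φ s' u' z₀)
    have e6 := abs_nonneg (∫ ξ in s..s', k ξ)
    linarith
  · have huI : u ∈ Icc S T := ⟨hs.trans hsu, hu⟩
    have hsI : s ∈ Icc S T := ⟨hs, hsu.trans hu⟩
    have hs'I : s' ∈ Icc S T := ⟨hs', hs'T⟩
    have hu'I : u' ∈ Icc S T := ⟨hs'.trans hsu', hu'⟩
    have e1 := hmove s u hs hsu hu
    have e2 := hmove s' u' hs' hsu' hu'
    have e3 := hk.integral_nonneg huI.1 h.le hs'T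
    have e4 := hk.integral_adjacent hd hsI huI hs'I
    have e5 := hk.integral_adjacent hd huI hs'I hu'I
    have e6 := le_abs_self (∫ ξ in s..s', k ξ)
    have e7 := le_abs_self (∫ ξ in u..u', k ξ)
    have e8 := norm_sub_le_norm_sub_add_norm_sub (φ s u z₀) z₀ (φ s' u' z₀)
    rw [norm_sub_rev z₀] at e8
    have e9 : 0 ≤ 2 / R * |∫ ξ in s..s', k ξ| := by positivity
    linarith

theorem IsEvolutionFamily.continuousOn_triples (hd : 1 ≤ d) (hr : IsCanonicalSystem d r)
    (hφ : IsEvolutionFamily d r φ) (hS : 0 ≤ S) {K : Set ℂ} (hK : K ⊆ annulus (r S)) :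
    ContinuousOn (fun q : ℝ × ℝ × ℂ => φ q.1 q.2.1 q.2.2) (triples S T K) := by
  rintro ⟨s₀, τ, z₀⟩ ⟨⟨hs₀, hτ, hz₀⟩, hle₀⟩
  simp only [mem_ofPred_eq] at hs₀ hτ hz₀ hle₀
  have hST : S ≤ T := hτ.1.trans hτ.2
  obtain ⟨R, hR, hball⟩ := Metric.isOpen_iff.1 (isOpen_annulus (r S)) z₀ (hK hz₀)
  obtain ⟨k, hk0, hkL, hkb⟩ := hφ.regular S T hS hST z₀ (hK hz₀)
  have hk : IsDensity d S T k := ⟨hk0, hkL⟩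
  set l := 𝓝[triples S T K] ((s₀, τ, z₀) : ℝ × ℝ × ℂ) with hl
  have hmem : ∀ᶠ q in l, q ∈ triples S T K := self_mem_nhdsWithin
  have t0 : Tendsto (fun q : ℝ × ℝ × ℂ => q) l (𝓝 (s₀, τ, z₀)) := nhdsWithin_le_nhds
  have t1 : Tendsto (fun q : ℝ × ℝ × ℂ => q.1) l (𝓝[Icc S T] s₀) :=
    tendsto_nhdsWithin_iff.2 ⟨(continuous_fst.tendsto _).comp t0, hmem.mono fun q hq => hq.1.1⟩
  have t2 : Tendsto (fun q : ℝ × ℝ × ℂ => q.2.1) l (𝓝[Icc S T] τ) :=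
    tendsto_nhdsWithin_iff.2 ⟨((continuous_fst.comp continuous_snd).tendsto _).comp t0,
      hmem.mono fun q hq => hq.1.2.1⟩
  have t3 : Tendsto (fun q : ℝ × ℝ × ℂ => q.2.2) l (𝓝 z₀) :=
    ((continuous_snd.comp continuous_snd).tendsto _).comp t0
  have hI : ∀ {σ : ℝ} {f : ℝ × ℝ × ℂ → ℝ}, σ ∈ Icc S T → Tendsto f l (𝓝[Icc S T] σ) →
      Tendsto (fun q => |∫ ξ in (f q)..σ, k ξ|) l (𝓝 0) := by
    intro σ f hσ hf
    have h1 : Tendsto (fun _ : ℝ × ℝ × ℂ => σ) l (𝓝[Icc S T] σ) :=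
      tendsto_nhdsWithin_iff.2 ⟨tendsto_const_nhds, Eventually.of_forall fun _ => hσ⟩
    have h2 := ((hk.tendsto_integral hd hσ hσ).comp (hf.prodMk h1)).abs
    simpa using h2
  have i1 := hI hs₀ t1
  have i2 := hI hτ t2
  have hlim : Tendsto (fun q : ℝ × ℝ × ℂ => 2 / R * ‖q.2.2 - z₀‖ +
      (|∫ ξ in (q.2.1)..τ, k ξ| + (1 + 2 / R) * |∫ ξ in (q.1)..s₀, k ξ|)) l (𝓝 0) := by
    have := ((t3.sub_const z₀).norm.const_mul (2 / R)).add (i2.add (i1.const_mul (1 + 2 / R)))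
    simpa using this
  rw [ContinuousWithinAt, tendsto_iff_norm_sub_tendsto_zero]
  refine squeeze_zero' (Eventually.of_forall fun _ => norm_nonneg _) ?_ hlim
  filter_upwards [hmem, t3.eventually (Metric.ball_mem_nhds z₀ hR), i1.eventually_lt_const hR]
    with q hq hqz hqs
  obtain ⟨⟨hs, hu, -⟩, hle⟩ := hq
  simp only [mem_ofPred_eq] at hs hu hle
  have hs0 := hS.trans hs.1
  have e1 := norm_sub_le_of_ball_subset (hφ.holomorphic q.1 q.2.1 hs0 hle)
    (hφ.mapsTo q.1 q.2.1 hs0 hle) (hball.trans (hr.annulus_subset hS hs.1)) hqz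
  have e2 : ‖φ q.1 q.2.1 z₀ - φ s₀ τ z₀‖ ≤
      |∫ ξ in (q.2.1)..τ, k ξ| + (1 + 2 / R) * |∫ ξ in (q.1)..s₀, k ξ| := by
    rcases le_total q.1 s₀ with h | h
    · exact hφ.norm_sub_le_of_le hd hr hS hk hR hball hkb hs.1 h hle hle₀ hu.2 hτ.2
        ((le_abs_self _).trans_lt hqs)
    · rw [norm_sub_rev, intervalIntegral.integral_symm, abs_neg,
        intervalIntegral.integral_symm s₀, abs_neg]
      refine hφ.norm_sub_le_of_le hd hr hS hk hR hball hkb hs₀.1 h hle₀ hle hτ.2 hu.2 ?_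
      rw [intervalIntegral.integral_symm, abs_neg] at hqs
      exact (le_abs_self _).trans_lt hqs
  exact (norm_sub_le_norm_sub_add_norm_sub _ (φ q.1 q.2.1 z₀) _).trans (add_le_add e1 e2)

theorem IsEvolutionFamily.exists_density_of_isCompact (hd : 1 ≤ d) (hr : IsCanonicalSystem d r)
    (hφ : IsEvolutionFamily d r φ) (hS : 0 ≤ S) {K : Set ℂ} (hKc : IsCompact K)
    (hK : K ⊆ annulus (r S)) :
    ∃ k, IsDensity d S T k ∧ ∃ ε > 0, ∀ q ∈ triples S T K, ∀ t, q.2.1 ≤ t → t < q.2.1 + ε →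
      t ≤ T → ‖φ q.1 t q.2.2 - φ q.1 q.2.1 q.2.2‖ ≤ ∫ ξ in q.2.1..t, k ξ := by
  -- The doubled membership is needed because the compactness induction runs over arbitrary sets
  -- `V`, which may contain inadmissible triples.
  suffices h : ∃ k, IsDensity d S T k ∧ ∃ ε > 0, ∀ q ∈ triples S T K, q ∈ triples S T K →
      ∀ t, q.2.1 ≤ t → t < q.2.1 + ε → t ≤ T →
        ‖φ q.1 t q.2.2 - φ q.1 q.2.1 q.2.2‖ ≤ ∫ ξ in q.2.1..t, k ξ by
    obtain ⟨k, hk, ε, hε, h⟩ := h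
    exact ⟨k, hk, ε, hε, fun q hq => h q hq hq⟩
  refine (isCompact_triples S T hKc).induction_on (p := fun V => ∃ k, IsDensity d S T k ∧
    ∃ ε > 0, ∀ q ∈ V, q ∈ triples S T K → ∀ t, q.2.1 ≤ t → t < q.2.1 + ε → t ≤ T →
      ‖φ q.1 t q.2.2 - φ q.1 q.2.1 q.2.2‖ ≤ ∫ ξ in q.2.1..t, k ξ)
    ⟨_, IsDensity.zero, 1, one_pos, by simp⟩ ?_ ?_ ?_
  · rintro V V' hVV ⟨k, hk, ε, hε, h⟩
    exact ⟨k, hk, ε, hε, fun q hq => h q (hVV hq)⟩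
  · rintro V V' ⟨k, hk, ε, hε, h⟩ ⟨k', hk', ε', hε', h'⟩
    refine ⟨_, hk.add hk', min ε ε', lt_min hε hε', fun q hq hqX t hut htε htT => ?_⟩
    have hu : q.2.1 ∈ Icc S T := hqX.1.2.1
    rw [hk.integral_add hd hk' hu ⟨hu.1.trans hut, htT⟩]
    have e1 := hk.integral_nonneg hu.1 hut htT
    have e2 := hk'.integral_nonneg hu.1 hut htT
    rcases hq with hq | hq
    · have := h q hq hqX t hut (htε.trans_le (by gcongr; exact min_le_left _ _)) htT
      linarith
    · have := h' q hq hqX t hut (htε.trans_le (by gcongr; exact min_le_right _ _)) htT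
      linarith
  · rintro x hx
    have hτ : x.2.1 ∈ Icc S T := hx.1.2.1
    have hs₀ : x.1 ∈ Icc S T := hx.1.1
    have hle₀ : x.1 ≤ x.2.1 := hx.2
    have hw₀ : φ x.1 x.2.1 x.2.2 ∈ annulus (r x.2.1) :=
      hφ.mapsTo _ _ (hS.trans hs₀.1) hle₀ (hr.annulus_subset hS hs₀.1 (hK hx.1.2.2))
    obtain ⟨k, hk, R, hR, hev⟩ := hφ.hasLocalDensity hd hr hS hτ hw₀
    have hcont := (hφ.continuousOn_triples hd hr hS hK (T := T)) x hx
    obtain ⟨P, hP, Q, hQ, hPQ⟩ := eventually_prod_iff.1 hev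
    obtain ⟨ε, hε, hball⟩ := Metric.eventually_nhds_iff_ball.1
      ((eventually_nhdsWithin_iff.1 hP).and (eventually_nhdsWithin_iff.1 hQ))
    have hnear : ∀ᶠ q : ℝ × ℝ × ℂ in 𝓝[triples S T K] x, |q.2.1 - x.2.1| < ε / 2 := by
      have : ContinuousAt (fun q : ℝ × ℝ × ℂ => |q.2.1 - x.2.1|) x := by fun_prop
      exact nhdsWithin_le_nhds (this.eventually_lt_const (by simpa using hε))
    -- The middle time is within `ε / 2` of `τ` and the step is shorter than `ε / 2`, so both times
    -- stay within `ε` of `τ`.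
    refine ⟨_, hnear.and (hcont.eventually (Metric.ball_mem_nhds _ hR)), k, hk, ε / 2,
      half_pos hε, ?_⟩
    rintro q ⟨hq1, hq2⟩ ⟨⟨hs, hu, hz⟩, hle⟩ t hut htε htT
    simp only [mem_ofPred_eq] at hle
    rw [abs_lt] at hq1
    have ht : t ∈ Icc S T := ⟨hu.1.trans hut, htT⟩
    rw [hφ.comp q.1 q.2.1 t (hS.trans hs.1) hle hut _ (hr.annulus_subset hS hs.1 (hK hz))]
    refine hPQ ((hball _ ?_).1 hu) ((hball _ ?_).2 ht) hut _ hq2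
    · rw [Metric.mem_ball, Real.dist_eq, abs_lt]; constructor <;> linarith
    · rw [Metric.mem_ball, Real.dist_eq, abs_lt]; constructor <;> linarith

theorem IsDensity.norm_sub_le_of_local (hd : 1 ≤ d) {k : ℝ → ℝ} (hk : IsDensity d S T k)
    {f : ℝ → ℂ} {s ε : ℝ} (hs : S ≤ s) (hε : 0 < ε)
    (h : ∀ u t, s ≤ u → u ≤ t → t < u + ε → t ≤ T → ‖f t - f u‖ ≤ ∫ ξ in u..t, k ξ)
    {u t : ℝ} (hsu : s ≤ u) (hut : u ≤ t) (ht : t ≤ T) : ‖f t - f u‖ ≤ ∫ ξ in u..t, k ξ := by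
  -- The interval is covered by steps of length `ε / 2`, strictly below the admissible `ε`; the
  -- triangle inequality and additivity of the integral join them without loss.
  have key : ∀ n : ℕ, ∀ u, s ≤ u → u ≤ t → t ≤ u + n * (ε / 2) →
      ‖f t - f u‖ ≤ ∫ ξ in u..t, k ξ := by
    intro n
    induction n with
    | zero =>
      intro u hsu hut htu
      exact h u t hsu hut (by simp at htu; linarith) ht
    | succ n ih =>
      intro u hsu hut htu
      rcases lt_or_ge t (u + ε) with hlt | hge
      · exact h u t hsu hut hlt ht
      · push_cast at htu
        have h1 := h u (u + ε / 2) hsu (by linarith) (by linarith) (by linarith)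
        have h2 := ih (u + ε / 2) (by linarith) (by linarith) (by linarith)
        rw [← hk.integral_adjacent hd (v := u + ε / 2) ⟨by linarith, by linarith⟩
          ⟨by linarith, by linarith⟩ ⟨by linarith, ht⟩]
        have := norm_sub_le_norm_sub_add_norm_sub (f t) (f (u + ε / 2)) (f u)
        linarith
  obtain ⟨n, hn⟩ := exists_nat_ge ((t - u) / (ε / 2))
  rw [div_le_iff₀ (half_pos hε)] at hn
  exact key n u hsu hut (by linarith)

end

end AnnulusEvolution

theorem proposition4p5 (d : ℝ≥0∞) (hd : 1 ≤ d) (r : ℝ → ℝ) (φ : ℝ → ℝ → ℂ → ℂ)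
    (hr : AnnulusEvolution.IsCanonicalSystem d r)
    (hφ : AnnulusEvolution.IsEvolutionFamily d r φ)
    (S T : ℝ) (hS : 0 ≤ S) (hST : S ≤ T)
    (K : Set ℂ) (hK : IsCompact K) (hKS : K ⊆ AnnulusEvolution.annulus (r S)) :
    ∃ k : ℝ → ℝ, (∀ ξ ∈ Set.Icc S T, 0 ≤ k ξ) ∧
      MemLp k d (volume.restrict (Set.Icc S T)) ∧
      ∀ s u t : ℝ, S ≤ s → s ≤ u → u ≤ t → t ≤ T →
        AnnulusEvolution.supNormOn K (fun z => φ s t z - φ s u z) ≤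
          ENNReal.ofReal (∫ ξ in u..t, k ξ) := by
  obtain ⟨k, hk, ε, hε, h⟩ := hφ.exists_density_of_isCompact hd hr hS hK hKS (T := T)
  refine ⟨k, hk.1, hk.2, fun s u t hs hsu hut ht => iSup₂_le fun z hz => ?_⟩
  rw [← ofReal_norm]
  refine ENNReal.ofReal_le_ofReal ?_
  refine hk.norm_sub_le_of_local hd (f := fun t => φ s t z) hs hε ?_ hsu hut ht
  intro u t hsu hut htu ht
  exact h (s, u, z) ⟨⟨⟨hs, (hsu.trans hut).trans ht⟩, ⟨hs.trans hsu, hut.trans ht⟩, hz⟩, hsu⟩ t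
    hut htu ht
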